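/- Let $M$ be a compact $C^\infty$ manifold without boundary, of dimension $d$, with a smooth Riemannian metric $g$, and let $1\le n\le d$. Let $T^nM=TM\oplus\cdots\oplus TM$ ($n$ summands), with points $(x,v)=(x,v_1,\dots,v_n)$, $v_i\in T_xM$. Differential $n$-forms are regarded as functions on $T^nM$. **Holonomic measures.** For $\omega\in\Omega^n(M)$ put $\|\omega\|=\sup\{\omega_x(v_1,\dots,v_n):|v_i|\le 1\}$, and let $\mathrm{vol}_n(v_1,\dots,v_n)=\sup\{\omega_x(v_1,\dots,v_n):\omega\in\Omega^n(M),\ \|\omega\|\le 1\}$. A holonomic measure is a Borel probability measure $\mu$ on $T^nM$ with $\int \mathrm{vol}_n\,d\mu<\infty$ and $\int d\omega\,d\mu=0$ for all smooth $(n-1)$-forms $\omega\in\Omega^{n-1}(M)$. **Critical measures.** A mild distribution is a distribution $\eta$ on $T^nM$ such that $\sum_i|\langle\eta,\psi_i\omega\rangle|<\infty$ for every $\omega\in\Omega^n(M)$ and every locally finite smooth partition of unity $\{\psi_i\}_{i\in\mathbb N}\subset C_c^\infty(T^nM)$. A variation of a holonomic measure $\mu$ is a family $(\mu_t)_{t\ge0}$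 of holonomic measures with $\mu_0=\mu$ for which there is a mild distribution $\eta$ with $\frac{d}{dt}\big|_{t=0^+}\int f\,d\mu_t=\langle\eta,f\rangle$ for all $f\in C_c^\infty(T^nM)$. Let $L\in C^\infty(T^nM)$ and $A_L(\mu)=\int L\,d\mu$. The measure $\mu$ is critical for $A_L$ if $L$ is $\mu$-integrable and, for every variation $(\mu_t)$ of $\mu$ such that $L$ is $\mu_t$-integrable for all $t\ge0$ and $t\mapsto A_L(\mu_t)$ has a one-sided derivative at $t=0$, one has $\frac{d}{dt}\big|_{t=0^+}A_L(\mu_t)\ge0$. **Vertical gradients.** For a smooth function $f$ on $T^nM$, $\nabla_vf=(\nabla_{v_1}f,\dots,\nabla_{v_n}f)$, where $\nabla_{v_i}f(x,v)\in T_xM$ is defined by $g(w,\nabla_{v_i}f(x,v))=\frac{d}{dt}\big|_{t=0}f(x,v_1,\dots,v_i+tw,\dots,v_n)$ for all $w\in T_xM$. Let $\mathcal H$ be the Hilbert space of measurable $u:\operatorname{supp}\mu\to T^nM$ with $u(x,v)\in T^n_xM$ and $\int\sum_i g(u_i,u_i)\,d\mu<\infty$, modulo equality $\mu$-almost everywhere.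 **Proposition.** Let $\mu$ be a holonomic measure that is critical for $A_L$. Assume that $\nabla_vL|_{\operatorname{supp}\mu}\in\mathcal H$ and that $\nabla_vd\omega|_{\operatorname{supp}\mu}\in\mathcal H$ for every $\omega\in\Omega^{n-1}(M)$ (the latter is automatic if $n=1$, and both hold if $\operatorname{supp}\mu$ is compact). Then there is a sequence $(\omega^i)_{i\in\mathbb N}$ in $\Omega^{n-1}(M)$ such that $$\nabla_vL|_{\operatorname{supp}\mu}=\lim_{i\to\infty}\nabla_v d\omega^i|_{\operatorname{supp}\mu}\quad\text{in }\mathcal H.$$ -/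

import Mathlib

open MeasureTheory Filter Topology Set
open scoped Manifold ContDiff

noncomputable section

/-- The model space of a `d`-dimensional manifold. -/
abbrev Eucl (d : ℕ) : Type := EuclideanSpace ℝ (Fin d)

/-- The total space of the direct sum `T^n M = TM ⊕ ⋯ ⊕ TM` of `n` copies of the tangent bundle:
its points are `(x, v₁, …, v_n)` with `v₁, …, v_n ∈ T_x M`. -/
structure MultiTangent (d n : ℕ) (M : Type*) [TopologicalSpace M] [ChartedSpace (Eucl d) M] where
  base : M
  vec : Fin n → TangentSpace (𝓡 d) base

variable {d n k : ℕ} {M : Type*} [TopologicalSpace M] [ChartedSpace (Eucl d) M]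

/-- The `i`-th component `(x, v) ↦ (x, v_i)`, as a map to the tangent bundle. -/
def MultiTangent.component (i : Fin n) (p : MultiTangent d n M) : TangentBundle (𝓡 d) M :=
  ⟨p.base, p.vec i⟩

section Bundle

variable [IsManifold (𝓡 d) ∞ M]

/-- The topology of a direct sum of vector bundles: it is induced from the product
`M × TM × ⋯ × TM`, in which `T^n M` is the set of tuples with equal base points. -/
instance : TopologicalSpace (MultiTangent d n M) :=
  letI : IsManifold (𝓡 d) 1 M := IsManifold.of_le (n := ∞) (by exact_mod_cast le_top)
  TopologicalSpace.induced
    (fun p : MultiTangent d n M => (p.base, fun i => p.component i)) inferInstance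

instance : MeasurableSpace (MultiTangent d n M) := borel _

instance : BorelSpace (MultiTangent d n M) := ⟨rfl⟩

end Bundle

/-- The local parametrization of `T^n M` given by the chart `φ` of `M` at `x₀`:
`(y, w₁, …, w_n) ↦ (φ⁻¹ y, D(φ⁻¹)_y w₁, …, D(φ⁻¹)_y w_n)`. It is used for `y` in the target of `φ`,
that is, on the open set `bundleChartDomain x₀ n`. -/
def bundleParam (x₀ : M) (n : ℕ) (z : Eucl d × (Fin n → Eucl d)) : MultiTangent d n M where
  base := (extChartAt (𝓡 d) x₀).symm z.1
  vec := fun i => mfderiv 𝓘(ℝ, Eucl d) (𝓡 d) (extChartAt (𝓡 d) x₀).symm z.1 (z.2 i)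

/-- The open subset of `ℝ^d × (ℝ^d)^n` on which `bundleParam x₀ n` is a parametrization. -/
def bundleChartDomain (x₀ : M) (n : ℕ) : Set (Eucl d × (Fin n → Eucl d)) :=
  (extChartAt (𝓡 d) x₀).target ×ˢ univ

/-- Smoothness (`C^∞`) of a real function on `T^n M`. -/
def IsSmoothOnTn (f : MultiTangent d n M → ℝ) : Prop :=
  ∀ x₀ : M, ContDiffOn ℝ ∞ (f ∘ bundleParam x₀ n) (bundleChartDomain x₀ n)

/-! ### Differential forms -/

/-- The expression of a `k`-form in the chart of `M` at `x₀`, that is, its pullback under the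
inverse of the chart. -/
def formInChart (θ : ∀ x : M, TangentSpace (𝓡 d) x [⋀^Fin k]→L[ℝ] ℝ) (x₀ : M) (y : Eucl d) :
    Eucl d [⋀^Fin k]→L[ℝ] ℝ :=
  (θ ((extChartAt (𝓡 d) x₀).symm y)).compContinuousLinearMap
    (mfderiv 𝓘(ℝ, Eucl d) (𝓡 d) (extChartAt (𝓡 d) x₀).symm y)

variable (d k M) in
/-- The space `Ω^k(M)` of smooth differential `k`-forms on `M`. -/
structure SmoothForm where
  toFun : ∀ x : M, TangentSpace (𝓡 d) x [⋀^Fin k]→L[ℝ] ℝ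
  smooth : ∀ x₀ : M, ContDiffOn ℝ ∞ (formInChart toFun x₀) (extChartAt (𝓡 d) x₀).target

/-- A `k`-form regarded as a function on `T^k M`. -/
def SmoothForm.eval (θ : SmoothForm d k M) (p : MultiTangent d k M) : ℝ := θ.toFun p.base p.vec

/-- The exterior derivative at `x`, computed in the chart at `x`. -/
def SmoothForm.extDer (θ : SmoothForm d k M) (x : M) : TangentSpace (𝓡 d) x [⋀^Fin (k + 1)]→L[ℝ] ℝ :=
  (extDeriv (formInChart θ.toFun x) (extChartAt (𝓡 d) x x)).compContinuousLinearMap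
    (mfderiv (𝓡 d) 𝓘(ℝ, Eucl d) (extChartAt (𝓡 d) x) x)

/-- The exterior derivative `dθ` of a `k`-form, regarded as a function on `T^{k+1} M`. -/
def SmoothForm.dEval (θ : SmoothForm d k M) (p : MultiTangent d (k + 1) M) : ℝ :=
  θ.extDer p.base p.vec

theorem SmoothForm.isSmoothOnTn_eval (θ : SmoothForm d k M) : IsSmoothOnTn θ.eval := by
  intro x₀
  have h1 : ContDiff ℝ ∞ (fun q : (Eucl d [⋀^Fin k]→L[ℝ] ℝ) × (Fin k → Eucl d) => q.1 q.2) := by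
    have := (ContinuousAlternatingMap.toContinuousMultilinearMapCLM (𝕜 := ℝ) (E := Eucl d) (F := ℝ)
      (ι := Fin k) ℝ).analyticOnNhd_uncurry_of_multilinear (s := univ)
    exact contDiffOn_univ.1 (this.contDiffOn uniqueDiffOn_univ)
  have h2 : ContDiffOn ℝ ∞ (fun z : Eucl d × (Fin k → Eucl d) =>
      (formInChart θ.toFun x₀ z.1, z.2)) (bundleChartDomain x₀ k) :=
    ((θ.smooth x₀).comp contDiff_fst.contDiffOn (fun z hz => hz.1)).prodMk contDiff_snd.contDiffOn
  exact h1.comp_contDiffOn h2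

/-! ### Test functions and distributions -/

section Manifold

variable [IsManifold (𝓡 d) ∞ M]

variable (d n M) in
/-- The space `C_c^∞(T^n M)`. -/
def TestFn : Submodule ℝ (MultiTangent d n M → ℝ) where
  carrier := {f | IsSmoothOnTn f ∧ HasCompactSupport f}
  add_mem' := fun hf hg => ⟨fun x₀ => (hf.1 x₀).add (hg.1 x₀), hf.2.add hg.2⟩
  zero_mem' := ⟨fun _ => contDiffOn_const, HasCompactSupport.zero⟩
  smul_mem' := fun _ _ hf => ⟨fun x₀ => contDiffOn_const.smul (hf.1 x₀), hf.2.smul_left⟩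

/-- The product `ψ θ` of a test function and an `n`-form, as a test function. -/
def TestFn.mulForm (ψ : TestFn d n M) (θ : SmoothForm d n M) : TestFn d n M :=
  ⟨ψ.1 * θ.eval, fun x₀ => (ψ.2.1 x₀).mul (θ.isSmoothOnTn_eval x₀), ψ.2.2.mul_right⟩

/-- A linear functional on `C_c^∞(T^n M)` is a distribution if in every bundle chart and on every
compact subset of it, it is bounded by finitely many derivatives of the test function. -/
def IsDistribution (η : TestFn d n M →ₗ[ℝ] ℝ) : Prop :=
  ∀ (x₀ : M) (K : Set (Eucl d × (Fin n → Eucl d))), IsCompact K → K ⊆ bundleChartDomain x₀ n →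
    ∃ (N : ℕ) (C : ℝ), ∀ f : TestFn d n M, tsupport f.1 ⊆ bundleParam x₀ n '' K →
      ∀ B : ℝ, 0 ≤ B →
        (∀ j ≤ N, ∀ z ∈ K, ‖iteratedFDeriv ℝ j (f.1 ∘ bundleParam x₀ n) z‖ ≤ B) →
        |η f| ≤ C * B

/-- A smooth, compactly supported, locally finite partition of unity on `T^n M`. -/
structure IsPartitionOfUnity (ψ : ℕ → TestFn d n M) : Prop where
  nonneg : ∀ i p, 0 ≤ (ψ i).1 p
  locallyFinite : LocallyFinite fun i => Function.support (ψ i).1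
  sum_eq_one : ∀ p, ∑ᶠ i, (ψ i).1 p = 1

/-- A mild distribution: `∑ ⟨η, ψ_i θ⟩` converges absolutely for all `n`-forms `θ` and all
partitions of unity. -/
def IsMildDistribution (η : TestFn d n M →ₗ[ℝ] ℝ) : Prop :=
  IsDistribution η ∧ ∀ ψ : ℕ → TestFn d n M, IsPartitionOfUnity ψ →
    ∀ θ : SmoothForm d n M, Summable fun i => |η (TestFn.mulForm (ψ i) θ)|

/-! ### Riemannian structure, mass, and holonomic measures -/

variable (d M) in
/-- Smooth Riemannian metrics on `M`. -/
abbrev SmoothMetric : Type _ :=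
  Bundle.ContMDiffRiemannianMetric (𝓡 d) ∞ (Eucl d) (fun x : M => TangentSpace (𝓡 d) x)

/-- The comass condition `‖θ‖ ≤ 1`: `θ_x(v₁, …, v_n) ≤ 1` whenever `|v_i| ≤ 1` for all `i`. -/
def ComassLeOne (g : SmoothMetric d M) (θ : SmoothForm d n M) : Prop :=
  ∀ p : MultiTangent d n M, (∀ i, g.inner p.base (p.vec i) (p.vec i) ≤ 1) → θ.eval p ≤ 1

/-- The volume function `vol_n(v₁, …, v_n)`, the supremum of `θ_x(v₁, …, v_n)` over `‖θ‖ ≤ 1`. -/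
def volN (g : SmoothMetric d M) (p : MultiTangent d n M) : ENNReal :=
  ⨆ (θ : SmoothForm d n M) (_ : ComassLeOne g θ), ENNReal.ofReal (θ.eval p)

/-- A (positive Borel) measure on `T^n M` is mild if its mass `∫ vol_n dμ` is finite. -/
def IsMild (g : SmoothMetric d M) (μ : Measure (MultiTangent d n M)) : Prop :=
  ∫⁻ p, volN g p ∂μ < (⊤ : ENNReal)

/-- Holonomic measures on `T^{k+1} M`: mild probability measures with `∫ dθ dμ = 0` for every
`θ ∈ Ω^k(M)`. -/
structure IsHolonomic (g : SmoothMetric d M) (μ : Measure (MultiTangent d (k + 1) M)) : Prop where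
  prob : IsProbabilityMeasure μ
  mild : IsMild g μ
  closed : ∀ θ : SmoothForm d k M, ∫ p, θ.dEval p ∂μ = 0

/-- A variation of `μ`: a family `μ_t`, `t ≥ 0`, of holonomic measures with `μ_0 = μ` that has a
one-sided derivative at `t = 0` which is a mild distribution. (The values at `t < 0` play no
role.) -/
structure IsVariation (g : SmoothMetric d M) (μ : Measure (MultiTangent d (k + 1) M))
    (μt : ℝ → Measure (MultiTangent d (k + 1) M)) : Prop where
  holonomic : ∀ t, 0 ≤ t → IsHolonomic g (μt t)
  init : μt 0 = μ
  differentiable : ∃ η : TestFn d (k + 1) M →ₗ[ℝ] ℝ, IsMildDistribution η ∧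
    ∀ f : TestFn d (k + 1) M, HasDerivWithinAt (fun t => ∫ p, f.1 p ∂(μt t)) (η f) (Ici 0) 0

/-- `μ` is critical for the action `A_L(μ) = ∫ L dμ`: the action of `μ` is defined, and along every
variation of `μ` along which the action is defined and has a one-sided derivative at `t = 0`, this
derivative is nonnegative. -/
def IsCritical (g : SmoothMetric d M) (L : MultiTangent d (k + 1) M → ℝ)
    (μ : Measure (MultiTangent d (k + 1) M)) : Prop :=
  Integrable L μ ∧
  ∀ μt : ℝ → Measure (MultiTangent d (k + 1) M), IsVariation g μ μt →
    (∀ t, 0 ≤ t → Integrable L (μt t)) →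
    ∀ a : ℝ, HasDerivWithinAt (fun t => ∫ p, L p ∂(μt t)) a (Ici 0) 0 → 0 ≤ a

/-! ### The vertical gradient and the Hilbert space of square-integrable sections -/

/-- The property that `z ∈ T_x M` is the vertical gradient `∇_{v_i} f` at `p = (x, v)`:
`g(w, z)` is the derivative of `f` in the direction of `w` in the `i`-th slot, for all `w`. -/
def IsVertGrad (g : SmoothMetric d M) (f : MultiTangent d n M → ℝ) (p : MultiTangent d n M) (i : Fin n)
    (z : TangentSpace (𝓡 d) p.base) : Prop :=
  ∀ w : TangentSpace (𝓡 d) p.base,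
    HasDerivAt (fun t : ℝ => f ⟨p.base, Function.update p.vec i (p.vec i + t • w)⟩)
      (g.inner p.base w z) 0

open Classical in
/-- The vertical gradient `∇_v f = (∇_{v_1} f, …, ∇_{v_n} f)`, a section over `T^n M` with values
in `T^n_x M` at `(x, v)` (set to `0` where it does not exist). -/
def vertGrad (g : SmoothMetric d M) (f : MultiTangent d n M → ℝ) (p : MultiTangent d n M) (i : Fin n) :
    TangentSpace (𝓡 d) p.base :=
  if h : ∃ z, IsVertGrad g f p i z then h.choose else 0

theorem IsVertGrad.eq_vertGrad {g : SmoothMetric d M} {f : MultiTangent d n M → ℝ}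
    {p : MultiTangent d n M} {i : Fin n} {z : TangentSpace (𝓡 d) p.base}
    (hz : IsVertGrad g f p i z) : vertGrad g f p i = z := by
  have h : ∃ z, IsVertGrad g f p i z := ⟨z, hz⟩
  rw [vertGrad, dif_pos h]
  have hc := h.choose_spec
  by_contra hne
  have hpos := g.pos p.base (h.choose - z) (sub_ne_zero.2 hne)
  have := (hc (h.choose - z)).unique (hz (h.choose - z))
  rw [map_sub (g.inner p.base (h.choose - z)), this, sub_self] at hpos
  exact lt_irrefl _ hpos

/-- The squared norm `∫_{supp μ} g(u, u) dμ` of a section `u`, where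
`g(u, u) = g(u₁, u₁) + ⋯ + g(u_n, u_n)`. -/
def sqNorm (g : SmoothMetric d M) (μ : Measure (MultiTangent d n M))
    (u : ∀ p : MultiTangent d n M, Fin n → TangentSpace (𝓡 d) p.base) : ENNReal :=
  ∫⁻ p in μ.support, ENNReal.ofReal (∑ i, g.inner p.base (u p i) (u p i)) ∂μ

/-- The section `u` (restricted to `supp μ`) represents an element of the Hilbert space of measurable
square-integrable sections. -/
def MemL2 (g : SmoothMetric d M) (μ : Measure (MultiTangent d n M))
    (u : ∀ p : MultiTangent d n M, Fin n → TangentSpace (𝓡 d) p.base) : Prop :=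
  AEMeasurable (fun p => (⟨p.base, u p⟩ : MultiTangent d n M)) (μ.restrict μ.support) ∧
    sqNorm g μ u < (⊤ : ENNReal)

/-- Convergence `u_i → u` in the Hilbert space of square-integrable sections over `supp μ`. -/
def TendstoL2 (g : SmoothMetric d M) (μ : Measure (MultiTangent d n M))
    (us : ℕ → ∀ p : MultiTangent d n M, Fin n → TangentSpace (𝓡 d) p.base)
    (u : ∀ p : MultiTangent d n M, Fin n → TangentSpace (𝓡 d) p.base) : Prop :=
  (∀ i, MemL2 g μ (us i)) ∧ MemL2 g μ u ∧
    Tendsto (fun i => sqNorm g μ (fun p j => us i p j - u p j)) atTop (𝓝 0)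

end Manifold

end

/-! By the Hilbert space projection theorem it suffices to show that every square-integrable
vertical field `U` orthogonal to all `∇_v dω` is orthogonal to `∇_v L`. Formally, moving `μ` in the
direction `U` preserves closedness to first order, so criticality gives `⟨U, ∇_v L⟩ ≥ 0`; applying
this to `-U` gives equality. The work lies in turning this infinitesimal motion into a family of
holonomic measures for all `t ≥ 0`.

Two devices make closedness exact. Since a form is affine in each vector separately, the vectors are
moved one at a time: with `n = k + 1`, the average of the push-forwards of `μ` under `v_i ↦ v_i + n
t U_i` integrates every form to an affine function of `t` (`eval_tuple_add`, `integral_eval_shift`).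
Since `U` may be unbounded, it is truncated to a set `S` where `U` and the fibre coordinates are
bounded; this destroys orthogonality by the contribution of the complement `P`. That contribution is
the pairing of forms with the `n`-vectors `∑ v₁ ∧ ⋯ ∧ U_i ∧ ⋯ ∧ v_n`. Expanding these in a basis and
absorbing signs into orientations represents it by a finite positive measure `tail` on bounded
tuples (`integral_eval_tail`). Adding `t` times `tail` and renormalising by `1 + t · tailMass` gives
a genuine variation (`isHolonomic_family`, `isMildDistribution`).

The mass of `tail` is finite because each coordinate of the `n`-vector is the derivative along `U`
of some exact form `dω`, hence a product of two square-integrable quantities (`multivectorCoord_eq`,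
`integrableOn_multivectorCoord`). As the truncation level grows, the tail mass tends to zero and the
first variation of the action tends to `⟨U, ∇_v L⟩` (`inner_grad_nonneg`).

The Hilbert space is handled in coordinates. A finite chart cover with a measurable choice of chart
yields a measurable frame in which the metric is uniformly comparable with the Euclidean one, and
the differentials along the fibres become elements of an ordinary `L²` space. -/

noncomputable section

variable {d n k : ℕ} {M : Type*} [TopologicalSpace M] [ChartedSpace (Eucl d) M]

set_option linter.unusedSectionVars false

/-! ### Frames and charts of the bundle `T^n M`. -/

section Geometry

variable [IsManifold (𝓡 d) ∞ M]

/-- The coordinate frame of the chart at `c`, at the point `x`. -/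
def chartFrame (c x : M) : Eucl d →L[ℝ] TangentSpace (𝓡 d) x :=
  (trivializationAt (Eucl d) (TangentSpace (𝓡 d)) c).symmL ℝ x

/-- Coordinates of tangent vectors at `x` with respect to the chart at `c`. -/
def chartCoframe (c x : M) : TangentSpace (𝓡 d) x →L[ℝ] Eucl d :=
  (trivializationAt (Eucl d) (TangentSpace (𝓡 d)) c).continuousLinearMapAt ℝ x

theorem chartCoframe_chartFrame {c x : M} (hx : x ∈ (chartAt (Eucl d) c).source) (w : Eucl d) :
    chartCoframe c x (chartFrame c x w) = w :=
  (trivializationAt (Eucl d) (TangentSpace (𝓡 d)) c).continuousLinearMapAt_symmL (R := ℝ)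
    (by simpa using hx) w

theorem chartFrame_chartCoframe {c x : M} (hx : x ∈ (chartAt (Eucl d) c).source)
    (v : TangentSpace (𝓡 d) x) : chartFrame c x (chartCoframe c x v) = v :=
  (trivializationAt (Eucl d) (TangentSpace (𝓡 d)) c).symmL_continuousLinearMapAt (R := ℝ)
    (by simpa using hx) v

theorem chartCoframe_eq_mfderiv {c x : M} (hx : x ∈ (chartAt (Eucl d) c).source) :
    chartCoframe c x = mfderiv (𝓡 d) 𝓘(ℝ, Eucl d) (extChartAt (𝓡 d) c) x :=
  TangentBundle.continuousLinearMapAt_trivializationAt hx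

theorem symm_mem_source {c : M} {y : Eucl d} (hy : y ∈ (extChartAt (𝓡 d) c).target) :
    (extChartAt (𝓡 d) c).symm y ∈ (chartAt (Eucl d) c).source := by
  simpa using (extChartAt (𝓡 d) c).map_target hy

theorem chartFrame_eq_mfderiv {c : M} {y : Eucl d} (hy : y ∈ (extChartAt (𝓡 d) c).target) :
    chartFrame c ((extChartAt (𝓡 d) c).symm y) =
      mfderiv 𝓘(ℝ, Eucl d) (𝓡 d) (extChartAt (𝓡 d) c).symm y := by
  have h := TangentBundle.symmL_trivializationAt (𝕜 := ℝ) (I := 𝓡 d) (symm_mem_source hy)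
  rw [(extChartAt (𝓡 d) c).right_inv hy] at h
  have h2 : range (𝓡 d) = univ := by simp
  rw [h2, mfderivWithin_univ] at h
  exact h

/-- The point of `T^n M` over `x` with coordinates `w` in the chart at `c`. -/
def frameTuple (c x : M) (w : Fin n → Eucl d) : MultiTangent d n M where
  base := x
  vec := fun i => chartFrame c x (w i)

/-- The fibre coordinates of a point of `T^n M` in the chart at `c`. -/
def fibreCoord (c : M) (p : MultiTangent d n M) : Fin n → Eucl d :=
  fun i => chartCoframe c p.base (p.vec i)

theorem MultiTangent.ext_vec {x : M} {v w : Fin n → TangentSpace (𝓡 d) x} (h : ∀ i, v i = w i) :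
    (⟨x, v⟩ : MultiTangent d n M) = ⟨x, w⟩ := by
  rw [funext h]

theorem frameTuple_fibreCoord {c : M} {p : MultiTangent d n M}
    (hp : p.base ∈ (chartAt (Eucl d) c).source) : frameTuple c p.base (fibreCoord c p) = p := by
  obtain ⟨x, v⟩ := p
  exact MultiTangent.ext_vec fun i => chartFrame_chartCoframe hp (v i)

theorem fibreCoord_frameTuple {c x : M} (hx : x ∈ (chartAt (Eucl d) c).source)
    (w : Fin n → Eucl d) : fibreCoord c (frameTuple c x w) = w :=
  funext fun i => chartCoframe_chartFrame hx (w i)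

theorem bundleParam_eq_frameTuple {c : M} {z : Eucl d × (Fin n → Eucl d)}
    (hz : z ∈ bundleChartDomain c n) :
    bundleParam c n z = frameTuple c ((extChartAt (𝓡 d) c).symm z.1) z.2 := by
  refine MultiTangent.ext_vec fun i => ?_
  rw [← chartFrame_eq_mfderiv hz.1]
  rfl

theorem mk_mem_bundleChartDomain {c x : M} (hx : x ∈ (chartAt (Eucl d) c).source)
    (w : Fin n → Eucl d) : (extChartAt (𝓡 d) c x, w) ∈ bundleChartDomain c n :=
  ⟨(extChartAt (𝓡 d) c).map_source (by simpa using hx), mem_univ _⟩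

theorem bundleParam_extChartAt {c x : M} (hx : x ∈ (chartAt (Eucl d) c).source)
    (w : Fin n → Eucl d) : bundleParam c n (extChartAt (𝓡 d) c x, w) = frameTuple c x w := by
  rw [bundleParam_eq_frameTuple (mk_mem_bundleChartDomain hx w)]
  simp only
  rw [(extChartAt (𝓡 d) c).left_inv (by simpa using hx)]

theorem isOpen_bundleChartDomain (c : M) (n : ℕ) : IsOpen (bundleChartDomain (d := d) c n) :=
  (isOpen_extChartAt_target c).prod isOpen_univ

theorem MultiTangent.isInducing : IsInducing
    (fun p : MultiTangent d n M => (p.base, fun i => p.component i)) := ⟨rfl⟩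

theorem MultiTangent.continuous_base : Continuous (MultiTangent.base : MultiTangent d n M → M) :=
  continuous_fst.comp MultiTangent.isInducing.continuous

theorem MultiTangent.continuous_component (i : Fin n) :
    Continuous (MultiTangent.component i : MultiTangent d n M → TangentBundle (𝓡 d) M) :=
  (continuous_apply i).comp (continuous_snd.comp MultiTangent.isInducing.continuous)

theorem isOpen_base_preimage {U : Set M} (hU : IsOpen U) :
    IsOpen ((MultiTangent.base : MultiTangent d n M → M) ⁻¹' U) :=
  hU.preimage MultiTangent.continuous_base

theorem continuousOn_fibreCoord (c : M) : ContinuousOn (fibreCoord c : MultiTangent d n M → _)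
    ((MultiTangent.base : MultiTangent d n M → M) ⁻¹' (chartAt (Eucl d) c).source) := by
  refine continuousOn_pi.2 fun i => ?_
  let e := trivializationAt (Eucl d) (TangentSpace (𝓡 d) : M → Type _) c
  have h := e.continuousOn.comp (MultiTangent.continuous_component (d := d) (n := n) (M := M) i).continuousOn
    (s := (MultiTangent.base : MultiTangent d n M → M) ⁻¹' (chartAt (Eucl d) c).source) (fun p hp => by
      rw [e.mem_source]; simpa [e, MultiTangent.component] using hp)
  refine (continuous_snd.comp_continuousOn h).congr fun p hp => ?_
  have hb : p.base ∈ e.baseSet := by simpa [e] using hp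
  simp only [fibreCoord, chartCoframe, Function.comp]
  rw [Bundle.Trivialization.continuousLinearMapAt_apply, Bundle.Trivialization.coe_linearMapAt_of_mem _ hb]
  rfl

theorem continuousOn_frameTuple (c : M) : ContinuousOn
    (fun q : M × (Fin n → Eucl d) => frameTuple c q.1 q.2)
    ((chartAt (Eucl d) c).source ×ˢ univ) := by
  rw [MultiTangent.isInducing.continuousOn_iff]
  refine continuousOn_fst.prodMk (continuousOn_pi.2 fun i => ?_)
  let e := trivializationAt (Eucl d) (TangentSpace (𝓡 d) : M → Type _) c
  have h := e.continuousOn_symm.comp (f := fun q : M × (Fin n → Eucl d) => (q.1, q.2 i))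
    (s := (chartAt (Eucl d) c).source ×ˢ univ) (by fun_prop) (fun q hq => by
      simpa [e] using hq)
  refine h.congr fun q hq => ?_
  have hb : q.1 ∈ e.baseSet := by simpa [e] using hq
  simp only [Function.comp, MultiTangent.component, frameTuple, chartFrame]
  rw [Bundle.Trivialization.symmL_apply]
  exact hb

theorem continuousOn_bundleParam (c : M) :
    ContinuousOn (bundleParam (d := d) c n) (bundleChartDomain c n) := by
  have h := (continuousOn_frameTuple (n := n) c).comp
    (f := fun z : Eucl d × (Fin n → Eucl d) => ((extChartAt (𝓡 d) c).symm z.1, z.2))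
    (s := bundleChartDomain c n)
    (((continuousOn_extChartAt_symm c).comp continuousOn_fst fun z hz => hz.1).prodMk
      continuousOn_snd) (fun z hz => ⟨symm_mem_source hz.1, mem_univ _⟩)
  exact h.congr fun z hz => bundleParam_eq_frameTuple hz

/-- The coordinates of a point of `T^n M` in the bundle chart at `c`. -/
def bundleCoord (c : M) (p : MultiTangent d n M) : Eucl d × (Fin n → Eucl d) :=
  (extChartAt (𝓡 d) c p.base, fibreCoord c p)

theorem continuousOn_bundleCoord (c : M) : ContinuousOn (bundleCoord c : MultiTangent d n M → _)
    ((MultiTangent.base : MultiTangent d n M → M) ⁻¹' (chartAt (Eucl d) c).source) := by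
  refine ContinuousOn.prodMk ?_ (continuousOn_fibreCoord c)
  refine (continuousOn_extChartAt (I := 𝓡 d) c).comp MultiTangent.continuous_base.continuousOn ?_
  intro p hp
  simpa using hp

theorem bundleParam_bundleCoord {c : M} {p : MultiTangent d n M}
    (hp : p.base ∈ (chartAt (Eucl d) c).source) : bundleParam c n (bundleCoord c p) = p := by
  rw [bundleCoord, bundleParam_extChartAt hp, frameTuple_fibreCoord hp]

theorem IsSmoothOnTn.continuous {f : MultiTangent d n M → ℝ} (hf : IsSmoothOnTn f) :
    Continuous f := by
  rw [continuous_iff_continuousAt]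
  intro p
  have h := (hf p.base).continuousOn.comp (continuousOn_bundleCoord p.base)
    (fun q hq => mk_mem_bundleChartDomain hq _)
  have hU := isOpen_base_preimage (d := d) (n := n) (chartAt (Eucl d) p.base).open_source
  refine ((h.congr (g := f) fun q hq => ?_).continuousAt (hU.mem_nhds (mem_chart_source _ p.base)))
  simp only [Function.comp, bundleParam_bundleCoord hq]

/-- The chain rule, with frame and coframe being the derivatives of the inverse chart and of the
chart. Chart changes of forms thereby reduce to cancelling frames against coframes. -/
theorem fderiv_coordChange (b c : M) {y : Eucl d} (hy : y ∈ (extChartAt (𝓡 d) b).target)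
    (hyc : (extChartAt (𝓡 d) b).symm y ∈ (chartAt (Eucl d) c).source) (w : Eucl d) :
    fderiv ℝ (extChartAt (𝓡 d) c ∘ (extChartAt (𝓡 d) b).symm) y w =
      chartCoframe c ((extChartAt (𝓡 d) b).symm y)
        (chartFrame b ((extChartAt (𝓡 d) b).symm y) w) := by
  rw [chartCoframe_eq_mfderiv hyc, chartFrame_eq_mfderiv hy, ← mfderiv_eq_fderiv, mfderiv_comp (I' := 𝓡 d)]
  · rfl
  · exact mdifferentiableAt_extChartAt hyc
  · have := mdifferentiableWithinAt_extChartAt_symm (𝕜 := ℝ) (I := 𝓡 d) hy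
    rw [← mdifferentiableWithinAt_univ]
    simpa using this

theorem formInChart_eq (θ : ∀ x : M, TangentSpace (𝓡 d) x [⋀^Fin k]→L[ℝ] ℝ) {c : M} {y : Eucl d}
    (hy : y ∈ (extChartAt (𝓡 d) c).target) :
    formInChart θ c y = (θ ((extChartAt (𝓡 d) c).symm y)).compContinuousLinearMap
      (chartFrame c ((extChartAt (𝓡 d) c).symm y)) := by
  rw [formInChart, chartFrame_eq_mfderiv hy]

end Geometry

/-! ### Chart independence of the exterior derivative and linear structure on forms. -/

section Forms

variable [IsManifold (𝓡 d) ∞ M]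

theorem SmoothForm.differentiableAt_formInChart (θ : SmoothForm d k M) {c : M} {y : Eucl d}
    (hy : y ∈ (extChartAt (𝓡 d) c).target) : DifferentiableAt ℝ (formInChart θ.toFun c) y :=
  ((θ.smooth c).contDiffAt ((isOpen_extChartAt_target c).mem_nhds hy)).differentiableAt (by simp)

theorem contDiffAt_coordChange (b c : M) {y : Eucl d} (hy : y ∈ (extChartAt (𝓡 d) b).target)
    (hyc : (extChartAt (𝓡 d) b).symm y ∈ (chartAt (Eucl d) c).source) :
    ContDiffAt ℝ ∞ (extChartAt (𝓡 d) c ∘ (extChartAt (𝓡 d) b).symm) y := by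
  have h := contDiffWithinAt_ext_coord_change (𝕜 := ℝ) (I := 𝓡 d) (n := ∞) c b (y := y)
    (by simpa [PartialEquiv.trans_source] using And.intro (by simpa using hy) (by simpa using hyc))
  simpa [contDiffWithinAt_univ] using h

theorem eventually_symm_mem_source (b c : M) {y : Eucl d} (hy : y ∈ (extChartAt (𝓡 d) b).target)
    (hyc : (extChartAt (𝓡 d) b).symm y ∈ (chartAt (Eucl d) c).source) :
    ∀ᶠ z in 𝓝 y, z ∈ (extChartAt (𝓡 d) b).target ∧
      (extChartAt (𝓡 d) b).symm z ∈ (chartAt (Eucl d) c).source := by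
  refine ((isOpen_extChartAt_target b).mem_nhds hy |> eventually_of_mem <| fun z hz => hz).and ?_
  have hc := (continuousOn_extChartAt_symm (I := 𝓡 d) b).continuousAt
    ((isOpen_extChartAt_target b).mem_nhds hy)
  exact hc.eventually ((chartAt (Eucl d) c).open_source.mem_nhds hyc)

/-- Change of charts for a differential form. -/
theorem formInChart_coordChange (θ : ∀ x : M, TangentSpace (𝓡 d) x [⋀^Fin k]→L[ℝ] ℝ) (b c : M)
    {y : Eucl d} (hy : y ∈ (extChartAt (𝓡 d) b).target)
    (hyc : (extChartAt (𝓡 d) b).symm y ∈ (chartAt (Eucl d) c).source) :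
    formInChart θ b y =
      (formInChart θ c ((extChartAt (𝓡 d) c ∘ (extChartAt (𝓡 d) b).symm) y)).compContinuousLinearMap
        (fderiv ℝ (extChartAt (𝓡 d) c ∘ (extChartAt (𝓡 d) b).symm) y) := by
  have hs : (extChartAt (𝓡 d) b).symm y ∈ (extChartAt (𝓡 d) c).source := by simpa using hyc
  rw [formInChart_eq θ hy, Function.comp_apply,
    formInChart_eq θ ((extChartAt (𝓡 d) c).map_source hs)]
  ext v
  -- The base points on the two sides are only propositionally equal, and the tangent spaces depend
  -- on them. Generalising over `x` allows substitution instead of rewriting under dependent types.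
  have key : ∀ (x : M) (u : Fin k → Eucl d) (hx : x = (extChartAt (𝓡 d) b).symm y)
      (hu : ∀ i, u i = fderiv ℝ (extChartAt (𝓡 d) c ∘ (extChartAt (𝓡 d) b).symm) y (v i)),
      θ ((extChartAt (𝓡 d) b).symm y)
        (fun i => chartFrame b ((extChartAt (𝓡 d) b).symm y) (v i)) =
      θ x (fun i => chartFrame c x (u i)) := by
    rintro x u rfl hu
    congr 1
    funext i
    rw [hu, fderiv_coordChange b c hy hyc, chartFrame_chartCoframe hyc]
  exact key _ _ ((extChartAt (𝓡 d) c).left_inv hs) fun i => rfl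

/-- The exterior derivative may be computed in every chart. -/
theorem SmoothForm.extDer_eq (θ : SmoothForm d k M) {c x : M}
    (hx : x ∈ (chartAt (Eucl d) c).source) :
    θ.extDer x = (extDeriv (formInChart θ.toFun c) (extChartAt (𝓡 d) c x)).compContinuousLinearMap
      (chartCoframe c x) := by
  have hy : extChartAt (𝓡 d) x x ∈ (extChartAt (𝓡 d) x).target := mem_extChartAt_target x
  have hxx : (extChartAt (𝓡 d) x).symm (extChartAt (𝓡 d) x x) = x := extChartAt_to_inv x
  have hyc : (extChartAt (𝓡 d) x).symm (extChartAt (𝓡 d) x x) ∈ (chartAt (Eucl d) c).source := by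
    rwa [hxx]
  -- Near the point the two local expressions differ by pullback along the transition map, so
  -- naturality of `extDeriv` applies.
  have hev : formInChart θ.toFun x =ᶠ[𝓝 (extChartAt (𝓡 d) x x)] fun y =>
      (formInChart θ.toFun c
        ((extChartAt (𝓡 d) c ∘ (extChartAt (𝓡 d) x).symm) y)).compContinuousLinearMap
        (fderiv ℝ (extChartAt (𝓡 d) c ∘ (extChartAt (𝓡 d) x).symm) y) := by
    filter_upwards [eventually_symm_mem_source x c hy hyc] with z hz
    exact formInChart_coordChange θ.toFun x c hz.1 hz.2
  have hcx : (extChartAt (𝓡 d) c ∘ (extChartAt (𝓡 d) x).symm) (extChartAt (𝓡 d) x x) =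
      extChartAt (𝓡 d) c x := by
    simp only [Function.comp, hxx]
  have htc : extChartAt (𝓡 d) c x ∈ (extChartAt (𝓡 d) c).target :=
    (extChartAt (𝓡 d) c).map_source (by simpa using hx)
  rw [SmoothForm.extDer, hev.extDeriv_eq, extDeriv_pullback (r := ∞)
    (by rw [hcx]; exact θ.differentiableAt_formInChart htc)
    (contDiffAt_coordChange x c hy hyc) (by simpa using ENat.LEInfty.out),
    hcx]
  refine ContinuousAlternatingMap.ext fun v => ?_
  refine congrArg (extDeriv (formInChart θ.toFun c) (extChartAt (𝓡 d) c x)) (funext fun i => ?_)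
  have key : ∀ w : Eucl d, w = chartCoframe x x (v i) →
      fderiv ℝ (extChartAt (𝓡 d) c ∘ (extChartAt (𝓡 d) x).symm) (extChartAt (𝓡 d) x x) w =
        chartCoframe c x (v i) := by
    rintro w rfl
    rw [fderiv_coordChange x c hy hyc]
    have aux : ∀ x' : M, x' = x →
        chartCoframe c x' (chartFrame x x' (chartCoframe x x (v i))) = chartCoframe c x (v i) := by
      rintro x' rfl
      rw [chartFrame_chartCoframe (mem_chart_source _ x')]
    exact aux _ hxx
  exact key _ (by rw [chartCoframe_eq_mfderiv (mem_chart_source _ x)]; rfl)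

/-- In the definition of `extDer` the chart moves with the point. Fixing one chart exhibits
smoothness of the result. -/
theorem SmoothForm.formInChart_extDer (θ : SmoothForm d k M) {c : M} {y : Eucl d}
    (hy : y ∈ (extChartAt (𝓡 d) c).target) :
    formInChart θ.extDer c y = extDeriv (formInChart θ.toFun c) y := by
  rw [formInChart_eq _ hy, θ.extDer_eq (symm_mem_source hy), (extChartAt (𝓡 d) c).right_inv hy]
  ext v
  simp only [ContinuousAlternatingMap.compContinuousLinearMap_apply, Function.comp_def,
    chartCoframe_chartFrame (symm_mem_source hy)]

/-- The exterior derivative as a smooth form. -/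
def SmoothForm.extD (θ : SmoothForm d k M) : SmoothForm d (k + 1) M where
  toFun := θ.extDer
  smooth c := by
    have h : ContDiffOn ℝ ∞ (extDeriv (formInChart θ.toFun c)) (extChartAt (𝓡 d) c).target := by
      have h1 := (θ.smooth c).fderiv_of_isOpen (m := ∞) (isOpen_extChartAt_target c) (by simp)
      exact (ContinuousAlternatingMap.alternatizeUncurryFinCLM ℝ (Eucl d) ℝ).contDiff.comp_contDiffOn h1
    exact h.congr fun y hy => θ.formInChart_extDer hy

theorem SmoothForm.eval_extD (θ : SmoothForm d k M) : θ.extD.eval = θ.dEval := rfl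

theorem SmoothForm.isSmoothOnTn_dEval (θ : SmoothForm d k M) : IsSmoothOnTn θ.dEval :=
  θ.extD.isSmoothOnTn_eval

instance : Zero (SmoothForm d k M) :=
  ⟨⟨fun _ => 0, fun c => by
    have h : formInChart (fun x : M => (0 : TangentSpace (𝓡 d) x [⋀^Fin k]→L[ℝ] ℝ)) c =
        fun _ => 0 := by
      funext y; ext v; rfl
    rw [h]
    exact contDiffOn_const⟩⟩

instance : Add (SmoothForm d k M) :=
  ⟨fun θ₁ θ₂ => ⟨fun x => θ₁.toFun x + θ₂.toFun x, fun c => by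
    have h : formInChart (fun x : M => θ₁.toFun x + θ₂.toFun x) c =
        fun y => formInChart θ₁.toFun c y + formInChart θ₂.toFun c y := by
      funext y; ext v; rfl
    rw [h]
    exact (θ₁.smooth c).add (θ₂.smooth c)⟩⟩

instance : SMul ℝ (SmoothForm d k M) :=
  ⟨fun a θ => ⟨fun x => a • θ.toFun x, fun c => by
    have h : formInChart (fun x : M => a • θ.toFun x) c = fun y => a • formInChart θ.toFun c y := by
      funext y; ext v; rfl
    rw [h]
    exact (θ.smooth c).const_smul a⟩⟩

theorem SmoothForm.eval_smul (a : ℝ) (θ : SmoothForm d k M) (p : MultiTangent d k M) :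
    (a • θ).eval p = a * θ.eval p := rfl

theorem SmoothForm.dEval_zero (p : MultiTangent d (k + 1) M) :
    (0 : SmoothForm d k M).dEval p = 0 := by
  -- Writing zero as a scalar multiple lets `extDeriv_smul` annihilate the derivative.
  have h : formInChart (0 : SmoothForm d k M).toFun p.base = (0 : ℝ) • fun _ => 0 := by
    funext y; ext v; rw [zero_smul]; rfl
  rw [SmoothForm.dEval, SmoothForm.extDer, h, extDeriv_smul, zero_smul]
  rfl

theorem SmoothForm.dEval_add (θ₁ θ₂ : SmoothForm d k M) (p : MultiTangent d (k + 1) M) :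
    (θ₁ + θ₂).dEval p = θ₁.dEval p + θ₂.dEval p := by
  have h : formInChart (θ₁ + θ₂).toFun p.base =
      formInChart θ₁.toFun p.base + formInChart θ₂.toFun p.base := by
    funext y; ext v; rfl
  have hy := mem_extChartAt_target (I := 𝓡 d) p.base
  simp only [SmoothForm.dEval, SmoothForm.extDer]
  rw [h, extDeriv_add (θ₁.differentiableAt_formInChart hy) (θ₂.differentiableAt_formInChart hy)]
  rfl

theorem SmoothForm.dEval_smul (a : ℝ) (θ : SmoothForm d k M) (p : MultiTangent d (k + 1) M) :
    (a • θ).dEval p = a * θ.dEval p := by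
  have h : formInChart (a • θ).toFun p.base = a • formInChart θ.toFun p.base := by
    funext y; ext v; rfl
  simp only [SmoothForm.dEval, SmoothForm.extDer]
  rw [h, extDeriv_smul]
  rfl

end Forms

/-! ### Alternating forms on `ℝ^d`: bases, constant forms and their primitives. -/

section LinearAlgebra

/-- A map into alternating forms on `ℝ^d` is smooth if all its evaluations are. -/
theorem contDiffAt_alternating_of_apply {X : Type*} [NormedAddCommGroup X] [NormedSpace ℝ X]
    {F : X → Eucl d [⋀^Fin k]→L[ℝ] ℝ} {x : X}
    (h : ∀ v : Fin k → Eucl d, ContDiffAt ℝ ∞ (fun y => F y v) x) : ContDiffAt ℝ ∞ F x := by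
  let b := (EuclideanSpace.basisFun (Fin d) ℝ).toBasis
  -- A form is determined by its values on basis tuples. A linear left inverse of `ev` starts from a
  -- finite-dimensional space, hence is continuous, and recovers `F` from finitely many scalar
  -- functions.
  let ev : (Eucl d [⋀^Fin k]→L[ℝ] ℝ) →ₗ[ℝ] ((Fin k → Fin d) → ℝ) :=
    { toFun := fun f J => f fun i => b (J i)
      map_add' := fun _ _ => rfl
      map_smul' := fun _ _ => rfl }
  have hinj : LinearMap.ker ev = ⊥ := by
    refine LinearMap.ker_eq_bot.2 fun f f' hf => ?_
    apply ContinuousAlternatingMap.toAlternatingMap_injective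
    apply AlternatingMap.coe_multilinearMap_injective
    exact Module.Basis.ext_multilinear (fun _ => b) fun J => congrFun hf J
  obtain ⟨l, hl⟩ := ev.exists_leftInverse_of_injective hinj
  have hF : F = fun y => l.toContinuousLinearMap (ev (F y)) := by
    funext y
    exact (LinearMap.congr_fun hl (F y)).symm
  rw [hF]
  refine l.toContinuousLinearMap.contDiff.contDiffAt.comp x ?_
  exact contDiffAt_pi.2 fun J => h _

/-- The form `dy^{J 0} ∧ ⋯ ∧ dy^{J (k-1)}` on `ℝ^d`. -/
def coordForm (J : Fin k → Fin d) : Eucl d [⋀^Fin k]→L[ℝ] ℝ :=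
  { (Matrix.detRowAlternating (n := Fin k) (R := ℝ)).compLinearMap
      (LinearMap.pi fun b => (EuclideanSpace.proj (𝕜 := ℝ) (J b)).toLinearMap) with
    cont := by
      change Continuous fun v : Fin k → Eucl d => Matrix.det (Matrix.of fun a b => v a (J b))
      refine Continuous.matrix_det ?_
      fun_prop }

theorem coordForm_apply (J : Fin k → Fin d) (v : Fin k → Eucl d) :
    coordForm J v = Matrix.det (Matrix.of fun a b => v a (J b)) := rfl

/-- The form `y^{I 0} dy^{I 1} ∧ ⋯ ∧ dy^{I k}` on `ℝ^d`. -/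
def primitiveForm (I : Fin (k + 1) → Fin d) (y : Eucl d) : Eucl d [⋀^Fin k]→L[ℝ] ℝ :=
  y (I 0) • coordForm fun b => I b.succ

theorem contDiff_primitiveForm (I : Fin (k + 1) → Fin d) : ContDiff ℝ ∞ (primitiveForm I) :=
  (EuclideanSpace.proj (𝕜 := ℝ) (I 0) : Eucl d →L[ℝ] ℝ).contDiff.smul contDiff_const

/-- The alternating sum defining the exterior derivative is the Laplace expansion of the determinant
along its first column, which comes from differentiating the coefficient `y (I 0)`. -/
theorem extDeriv_primitiveForm (I : Fin (k + 1) → Fin d) (y : Eucl d) :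
    extDeriv (primitiveForm I) y = coordForm I := by
  ext v
  rw [extDeriv_apply ((contDiff_primitiveForm I).differentiable (by simp)).differentiableAt,
    coordForm_apply, Matrix.det_succ_column_zero]
  refine Finset.sum_congr rfl fun i _ => ?_
  have h : (fun z => primitiveForm I z (i.removeNth v)) =
      fun z => coordForm (fun b => I b.succ) (i.removeNth v) • z (I 0) := by
    funext z
    simp [primitiveForm, mul_comm]
  have h2 : HasFDerivAt (fun z => primitiveForm I z (i.removeNth v))
      (coordForm (fun b => I b.succ) (i.removeNth v) •
        (EuclideanSpace.proj (𝕜 := ℝ) (I 0) : Eucl d →L[ℝ] ℝ)) y := by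
    rw [h]
    exact HasFDerivAt.const_smul (R := ℝ) (F := ℝ)
      (EuclideanSpace.proj (𝕜 := ℝ) (I 0) : Eucl d →L[ℝ] ℝ).hasFDerivAt _
  rw [h2.fderiv, mul_assoc, zsmul_eq_mul, Int.cast_pow, Int.cast_neg, Int.cast_one]
  refine congrArg (fun r : ℝ => (-1) ^ i.val * r) ?_
  exact mul_comm (coordForm (fun b => I b.succ) (i.removeNth v)) (v i (I 0))

/-- The tuple `(e_{I 0}, …, e_{I (n-1)})` of standard basis vectors. -/
def basisTuple (I : Fin n → Fin d) : Fin n → Eucl d := fun a => EuclideanSpace.single (I a) 1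

/-- Expansion of an alternating form in the standard basis. -/
theorem alternating_expansion (φ : Eucl d [⋀^Fin n]→L[ℝ] ℝ) (v : Fin n → Eucl d) :
    (n.factorial : ℝ) * φ v = ∑ I : Fin n → Fin d, coordForm I v * φ (basisTuple I) := by
  have h1 : ∀ w : Fin n → Eucl d,
      φ w = ∑ I : Fin n → Fin d, (∏ a, w a (I a)) * φ (basisTuple I) := by
    intro w
    have hw : w = fun a => ∑ j : Fin d, w a j • EuclideanSpace.single j (1 : ℝ) := by
      funext a
      have := (EuclideanSpace.basisFun (Fin d) ℝ).sum_repr (w a)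
      simpa using this.symm
    have h := φ.toMultilinearMap.map_sum (fun a j => w a j • EuclideanSpace.single j (1 : ℝ))
    conv_lhs => rw [hw]
    refine h.trans (Finset.sum_congr rfl fun I _ => ?_)
    rw [MultilinearMap.map_smul_univ]
    rfl
  have h2 : ∀ σ : Equiv.Perm (Fin n), φ v = ((Equiv.Perm.sign σ : ℤ) : ℝ) * φ (v ∘ σ) := by
    intro σ
    have := φ.toAlternatingMap.map_perm v σ
    have h3 : φ (v ∘ σ) = ((Equiv.Perm.sign σ : ℤ) : ℝ) * φ v := by
      refine this.trans ?_
      rw [Units.smul_def, zsmul_eq_mul]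
      rfl
    rw [h3, ← mul_assoc, ← Int.cast_mul, Int.units_coe_mul_self]
    simp
  -- Summing over all permutations of the arguments turns the products of coordinates in `h1` into
  -- determinants. All maps `I` are allowed, not only increasing ones, which accounts for the
  -- factorial.
  have h4 : (n.factorial : ℝ) * φ v = ∑ σ : Equiv.Perm (Fin n), φ v := by
    simp [Fintype.card_perm]
  rw [h4, Finset.sum_congr rfl fun σ _ => h2 σ]
  simp_rw [h1 (v ∘ _), Finset.mul_sum]
  rw [Finset.sum_comm]
  refine Finset.sum_congr rfl fun I _ => ?_
  rw [coordForm_apply, Matrix.det_apply, Finset.sum_mul]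
  refine Finset.sum_congr rfl fun σ _ => ?_
  rw [Units.smul_def, zsmul_eq_mul, mul_assoc]
  rfl

end LinearAlgebra

/-! ### Globalising forms given in a chart. -/

section LocalForms

variable [IsManifold (𝓡 d) ∞ M] [T2Space M]

/-- The form `χ α`, where `α` is a form on the chart domain and `χ` a bump function. -/
def bumpFormFun {c : M} (χ : SmoothBumpFunction (𝓡 d) c) (α : Eucl d → Eucl d [⋀^Fin k]→L[ℝ] ℝ)
    (x : M) : TangentSpace (𝓡 d) x [⋀^Fin k]→L[ℝ] ℝ :=
  χ x • (α (extChartAt (𝓡 d) c x)).compContinuousLinearMap (chartCoframe c x)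

theorem contDiffAt_alternating_apply {X : Type*} [NormedAddCommGroup X] [NormedSpace ℝ X]
    {A : X → Eucl d [⋀^Fin k]→L[ℝ] ℝ} {v : X → Fin k → Eucl d} {x : X}
    (hA : ContDiffAt ℝ ∞ A x) (hv : ContDiffAt ℝ ∞ v x) :
    ContDiffAt ℝ ∞ (fun y => A y (v y)) x := by
  have h1 : ContDiff ℝ ∞ (fun q : (Eucl d [⋀^Fin k]→L[ℝ] ℝ) × (Fin k → Eucl d) => q.1 q.2) := by
    have := (ContinuousAlternatingMap.toContinuousMultilinearMapCLM (𝕜 := ℝ) (E := Eucl d) (F := ℝ)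
      (ι := Fin k) ℝ).analyticOnNhd_uncurry_of_multilinear (s := univ)
    exact contDiffOn_univ.1 (this.contDiffOn uniqueDiffOn_univ)
  exact h1.contDiffAt.comp x (hA.prodMk hv)

/-- The global smooth form `χ α`. -/
def bumpForm {c : M} (χ : SmoothBumpFunction (𝓡 d) c) (α : Eucl d → Eucl d [⋀^Fin k]→L[ℝ] ℝ)
    (hα : ContDiff ℝ ∞ α) : SmoothForm d k M where
  toFun := bumpFormFun χ α
  smooth b := by
    intro y hy
    refine ContDiffAt.contDiffWithinAt (contDiffAt_alternating_of_apply fun v => ?_)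
    have hsymm := (continuousOn_extChartAt_symm (I := 𝓡 d) b).continuousAt
      ((isOpen_extChartAt_target b).mem_nhds hy)
    by_cases hyc : (extChartAt (𝓡 d) b).symm y ∈ (chartAt (Eucl d) c).source
    · set τ := extChartAt (𝓡 d) c ∘ (extChartAt (𝓡 d) b).symm with hτ
      have hev : (fun z => formInChart (bumpFormFun χ α) b z v) =ᶠ[𝓝 y] fun z =>
          χ ((extChartAt (𝓡 d) b).symm z) * α (τ z) fun i => fderiv ℝ τ z (v i) := by
        filter_upwards [eventually_symm_mem_source b c hy hyc] with z hz
        rw [formInChart_eq _ hz.1]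
        simp only [hτ, fderiv_coordChange b c hz.1 hz.2]
        rfl
      refine ContDiffAt.congr_of_eventuallyEq ?_ hev
      have hτs := contDiffAt_coordChange b c hy hyc
      refine ContDiffAt.mul ?_ (contDiffAt_alternating_apply (hα.contDiffAt.comp y hτs)
        (contDiffAt_pi.2 fun i => (hτs.fderiv_right (m := ∞) (by simp)).clm_apply contDiffAt_const))
      have h := χ.contMDiff.contMDiffAt.comp y
        ((contMDiffOn_extChartAt_symm (I := 𝓡 d) (n := ∞) b).contMDiffAt
          ((isOpen_extChartAt_target b).mem_nhds hy))
      exact h.contDiffAt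
    -- Outside the chart at `c` the point avoids the closed support of `χ`, so the form vanishes on
    -- a neighbourhood.
    · have hnot : (extChartAt (𝓡 d) b).symm y ∉ tsupport χ := fun h =>
        hyc (χ.tsupport_subset_chartAt_source h)
      have hev : (fun z => formInChart (bumpFormFun χ α) b z v) =ᶠ[𝓝 y] fun _ => 0 := by
        filter_upwards [hsymm.eventually ((isClosed_tsupport χ).isOpen_compl.mem_nhds hnot)] with z hz
        have h0 : χ ((extChartAt (𝓡 d) b).symm z) = 0 := image_eq_zero_of_notMem_tsupport hz
        change χ _ * _ = 0
        rw [h0, zero_mul]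
      exact contDiffAt_const.congr_of_eventuallyEq hev

/-- The cutoff is invisible to the derivative where `χ` is locally one. Thus each coordinate minor
on the fibres agrees locally with a globally defined exact form, which brings it under the
integrability hypothesis on exact forms. -/
theorem dEval_bumpForm_primitiveForm {c : M} (χ : SmoothBumpFunction (𝓡 d) c)
    (I : Fin (k + 1) → Fin d) (p : MultiTangent d (k + 1) M)
    (hp : p.base ∈ (chartAt (Eucl d) c).source) (h1 : χ =ᶠ[𝓝 p.base] 1) :
    (bumpForm χ (primitiveForm I) (contDiff_primitiveForm I)).dEval p =
      coordForm I (fibreCoord c p) := by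
  set θ := bumpForm χ (primitiveForm I) (contDiff_primitiveForm I)
  have hs : p.base ∈ (extChartAt (𝓡 d) c).source := by simpa using hp
  have hy : extChartAt (𝓡 d) c p.base ∈ (extChartAt (𝓡 d) c).target :=
    (extChartAt (𝓡 d) c).map_source hs
  have hev : formInChart θ.toFun c =ᶠ[𝓝 (extChartAt (𝓡 d) c p.base)] primitiveForm I := by
    have hsymm := (continuousOn_extChartAt_symm (I := 𝓡 d) c).continuousAt
      ((isOpen_extChartAt_target c).mem_nhds hy)
    rw [ContinuousAt, (extChartAt (𝓡 d) c).left_inv hs] at hsymm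
    filter_upwards [hsymm.eventually h1, (isOpen_extChartAt_target c).mem_nhds hy] with z hz hzt
    ext v
    rw [formInChart_eq _ hzt]
    change χ _ * primitiveForm I (extChartAt (𝓡 d) c ((extChartAt (𝓡 d) c).symm z)) _ = _
    rw [hz, (extChartAt (𝓡 d) c).right_inv hzt]
    rw [Pi.one_apply, one_mul]
    exact congrArg (primitiveForm I z)
      (funext fun i => chartCoframe_chartFrame (symm_mem_source hzt) (v i))
  rw [SmoothForm.dEval, θ.extDer_eq hp, hev.extDeriv_eq, extDeriv_primitiveForm]
  rfl

end LocalForms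

/-! ### A finite chart cover with uniform metric comparison and a measurable choice of chart. -/

section Cover

variable [IsManifold (𝓡 d) ∞ M]

open scoped Bundle in
/-- Near `c`, the metric is comparable with the Euclidean metric of the chart at `c`. -/
theorem exists_metric_comparison (g : SmoothMetric d M) (c : M) :
    ∃ C : ℝ, 0 < C ∧ ∀ᶠ x in 𝓝 c, ∀ w : Eucl d,
      g.inner x (chartFrame c x w) (chartFrame c x w) ≤ C * ‖w‖ ^ 2 ∧
      ‖w‖ ^ 2 ≤ C * g.inner x (chartFrame c x w) (chartFrame c x w) := by
  -- With `g` as the fibre norm, the local operator-norm bounds for trivializations give both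
  -- comparisons.
  let _ : Bundle.RiemannianBundle (fun x : M => TangentSpace (𝓡 d) x) := ⟨g.toRiemannianMetric⟩
  have _ : IsContinuousRiemannianBundle (Eucl d) (fun x : M => TangentSpace (𝓡 d) x) :=
    ⟨g.inner, g.contMDiff.continuous, fun _ _ _ => rfl⟩
  obtain ⟨C₁, hC₁, h₁⟩ := eventually_norm_symmL_trivializationAt_lt (Eucl d)
    (fun x : M => TangentSpace (𝓡 d) x) c
  obtain ⟨C₂, hC₂, h₂⟩ := eventually_norm_trivializationAt_lt (Eucl d)
    (fun x : M => TangentSpace (𝓡 d) x) c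
  refine ⟨C₁ ^ 2 + C₂ ^ 2, by positivity, ?_⟩
  filter_upwards [h₁, h₂, (chartAt (Eucl d) c).open_source.mem_nhds (mem_chart_source _ c)]
    with x hx₁ hx₂ hx w
  have hn : g.inner x (chartFrame c x w) (chartFrame c x w) = ‖chartFrame c x w‖ ^ 2 :=
    real_inner_self_eq_norm_sq (chartFrame c x w)
  have e₁ : ‖chartFrame c x w‖ ≤ C₁ * ‖w‖ :=
    ((chartFrame c x).le_opNorm w).trans (by gcongr; exact hx₁.le)
  have e₂ : ‖w‖ ≤ C₂ * ‖chartFrame c x w‖ := by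
    have := (chartCoframe c x).le_opNorm (chartFrame c x w)
    rw [chartCoframe_chartFrame hx] at this
    exact this.trans (by gcongr; exact hx₂.le)
  rw [hn]
  constructor
  · calc ‖chartFrame c x w‖ ^ 2 ≤ (C₁ * ‖w‖) ^ 2 := by gcongr
      _ ≤ _ := by nlinarith [sq_nonneg (C₂ * ‖w‖)]
  · calc ‖w‖ ^ 2 ≤ (C₂ * ‖chartFrame c x w‖) ^ 2 := by gcongr
      _ ≤ _ := by nlinarith [sq_nonneg (C₁ * ‖chartFrame c x w‖)]

/-- A finite cover of `M` by open subsets of charts on which the metric is comparable with the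
Euclidean one, with a measurable choice of a chart at each point. -/
structure ChartCover [T2Space M] (g : SmoothMetric d M) where
  centers : Finset M
  bump : ∀ c : M, SmoothBumpFunction (𝓡 d) c
  U : M → Set M
  C : ℝ
  center : M → M
  isOpen_U : ∀ c, IsOpen (U c)
  bump_eq_one : ∀ c, ∀ x ∈ U c, bump c =ᶠ[𝓝 x] 1
  C_pos : 0 < C
  inner_le : ∀ c ∈ centers, ∀ x ∈ U c, ∀ w : Eucl d,
    g.inner x (chartFrame c x w) (chartFrame c x w) ≤ C * ‖w‖ ^ 2
  le_inner : ∀ c ∈ centers, ∀ x ∈ U c, ∀ w : Eucl d,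
    ‖w‖ ^ 2 ≤ C * g.inner x (chartFrame c x w) (chartFrame c x w)
  center_mem : ∀ x, center x ∈ centers
  mem_U : ∀ x, x ∈ U (center x)
  measurableSet_center : ∀ c, MeasurableSet[borel M] {x | center x = c}

/-- Each inserted set takes precedence over the earlier ones, so the level sets are Boolean
combinations of open sets. This supplies a measurable global frame where a continuous one need not
exist. -/
theorem exists_measurable_choice {X : Type*} [TopologicalSpace X] [T2Space X] (U : X → Set X)
    (hU : ∀ c, IsOpen (U c)) (s : Finset X) :
    ∃ f : X → X, (∀ x ∈ ⋃ c ∈ s, U c, f x ∈ s ∧ x ∈ U (f x)) ∧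
      ∀ c, MeasurableSet[borel X] {x | f x = c} := by
  classical
  let _ : MeasurableSpace X := borel X
  have _ : BorelSpace X := ⟨rfl⟩
  induction s using Finset.induction_on with
  -- The default off the cover is the identity; its level sets are points, closed in a Hausdorff
  -- space.
  | empty => exact ⟨id, by simp, fun c => (isClosed_singleton (x := c)).measurableSet⟩
  | insert a s _ ih =>
    obtain ⟨f, hf, hm⟩ := ih
    refine ⟨fun x => if x ∈ U a then a else f x, fun x hx => ?_, fun c => ?_⟩
    · by_cases hxa : x ∈ U a
      · simp [hxa]
      · have hx' : x ∈ ⋃ c ∈ s, U c := by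
          simpa [hxa] using hx
        simp only [hxa, if_false]
        exact ⟨Finset.mem_insert_of_mem (hf x hx').1, (hf x hx').2⟩
    · have : {x | (if x ∈ U a then a else f x) = c} =
          (U a ∩ {_x | a = c}) ∪ ((U a)ᶜ ∩ {x | f x = c}) := by
        ext x
        by_cases hxa : x ∈ U a <;> simp [hxa]
      rw [this]
      exact ((hU a).measurableSet.inter (MeasurableSet.const _)).union
        ((hU a).measurableSet.compl.inter (hm c))

theorem nonempty_chartCover [T2Space M] [CompactSpace M] (g : SmoothMetric d M) :
    Nonempty (ChartCover g) := by
  choose C hC hev using exists_metric_comparison g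
  have hb : ∀ c : M, Nonempty (SmoothBumpFunction (𝓡 d) c) := fun c => inferInstance
  let χ : ∀ c : M, SmoothBumpFunction (𝓡 d) c := fun c => (hb c).some
  let U : M → Set M := fun c => interior {x | χ c x = 1} ∩ interior {x | ∀ w : Eucl d,
      g.inner x (chartFrame c x w) (chartFrame c x w) ≤ C c * ‖w‖ ^ 2 ∧
      ‖w‖ ^ 2 ≤ C c * g.inner x (chartFrame c x w) (chartFrame c x w)}
  have hUo : ∀ c, IsOpen (U c) := fun c => isOpen_interior.inter isOpen_interior
  have hUc : ∀ c, c ∈ U c := fun c =>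
    ⟨mem_interior_iff_mem_nhds.2 (χ c).eventuallyEq_one, mem_interior_iff_mem_nhds.2 (hev c)⟩
  obtain ⟨s, hs⟩ := isCompact_univ.elim_finite_subcover U hUo
    (fun x _ => mem_iUnion.2 ⟨x, hUc x⟩)
  obtain ⟨f, hf, hm⟩ := exists_measurable_choice U hUo s
  have hle : ∀ c ∈ s, C c ≤ ∑ b ∈ s, C b := fun c hc =>
    Finset.single_le_sum (f := C) (fun b _ => (hC b).le) hc
  -- The sum dominates every local constant; the added `1` keeps it positive even for an empty
  -- cover.
  refine ⟨⟨s, χ, U, 1 + ∑ c ∈ s, C c, f, hUo, fun c x hx => ?_, ?_, fun c hc x hx w => ?_,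
    fun c hc x hx w => ?_, fun x => (hf x (hs (mem_univ x))).1,
    fun x => (hf x (hs (mem_univ x))).2, hm⟩⟩
  · exact mem_interior_iff_mem_nhds.1 hx.1
  · have := Finset.sum_nonneg fun c (_ : c ∈ s) => (hC c).le
    linarith
  · have h := (interior_subset hx.2 w).1
    nlinarith [hle c hc, sq_nonneg ‖w‖]
  · have h := (interior_subset hx.2 w).2
    have h0 : 0 ≤ g.inner x (chartFrame c x w) (chartFrame c x w) := by
      by_contra hneg
      nlinarith [hC c, sq_nonneg ‖w‖]
    nlinarith [hle c hc]

end Cover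

/-! ### Measurability and compactness in the coordinates of the cover. -/

namespace ChartCover

variable [IsManifold (𝓡 d) ∞ M] [T2Space M] {g : SmoothMetric d M} (A : ChartCover g)

theorem mem_tsupport {c x : M} (hx : x ∈ A.U c) : x ∈ tsupport (A.bump c) := by
  refine subset_tsupport _ ?_
  rw [Function.mem_support, (A.bump_eq_one c x hx).eq_of_nhds]
  exact one_ne_zero

theorem U_subset_source (c : M) : A.U c ⊆ (chartAt (Eucl d) c).source := fun _ hx =>
  (A.bump c).tsupport_subset_chartAt_source (A.mem_tsupport hx)

theorem mem_source (x : M) : x ∈ (chartAt (Eucl d) (A.center x)).source :=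
  A.U_subset_source _ (A.mem_U x)

/-- The frame of `T_x M` chosen by the cover. -/
def frame (x : M) : Eucl d →L[ℝ] TangentSpace (𝓡 d) x := chartFrame (A.center x) x

/-- The coordinates on `T_x M` chosen by the cover. -/
def coframe (x : M) : TangentSpace (𝓡 d) x →L[ℝ] Eucl d := chartCoframe (A.center x) x

/-- The point of `T^n M` over `x` with coordinates `w`. -/
def tuple (x : M) (w : Fin n → Eucl d) : MultiTangent d n M := frameTuple (A.center x) x w

/-- The fibre coordinates of a point of `T^n M`. -/
def coord (p : MultiTangent d n M) : Fin n → Eucl d := fibreCoord (A.center p.base) p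

theorem coframe_frame (x : M) (w : Eucl d) : A.coframe x (A.frame x w) = w :=
  chartCoframe_chartFrame (A.mem_source x) w

theorem frame_coframe (x : M) (v : TangentSpace (𝓡 d) x) : A.frame x (A.coframe x v) = v :=
  chartFrame_chartCoframe (A.mem_source x) v

theorem tuple_coord (p : MultiTangent d n M) : A.tuple p.base (A.coord p) = p :=
  frameTuple_fibreCoord (A.mem_source p.base)

theorem coord_tuple (x : M) (w : Fin n → Eucl d) : A.coord (A.tuple x w) = w :=
  fibreCoord_frameTuple (A.mem_source x) w

theorem inner_frame_le (x : M) (w : Eucl d) :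
    g.inner x (A.frame x w) (A.frame x w) ≤ A.C * ‖w‖ ^ 2 :=
  A.inner_le _ (A.center_mem x) x (A.mem_U x) w

theorem le_inner_frame (x : M) (w : Eucl d) :
    ‖w‖ ^ 2 ≤ A.C * g.inner x (A.frame x w) (A.frame x w) :=
  A.le_inner _ (A.center_mem x) x (A.mem_U x) w

theorem measurableSet_piece (c : M) :
    MeasurableSet ({p | A.center p.base = c} : Set (MultiTangent d n M)) := by
  let _ : MeasurableSpace M := borel M
  have _ : BorelSpace M := ⟨rfl⟩
  exact (A.measurableSet_center c).preimage
    (MultiTangent.continuous_base (d := d) (n := n) (M := M)).measurable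

/-- A map is measurable if it is continuous in the charts of the cover. -/
theorem measurable_of_pieces {X : Type*} [MeasurableSpace X] {F : MultiTangent d n M → X}
    (h : ∀ c ∈ A.centers, ∀ s : Set X, MeasurableSet s →
      MeasurableSet ({p | A.center p.base = c} ∩ F ⁻¹' s)) : Measurable F := by
  intro s hs
  have : F ⁻¹' s = ⋃ c ∈ A.centers, ({p | A.center p.base = c} ∩ F ⁻¹' s) := by
    ext p
    simp only [mem_iUnion, mem_inter_iff, mem_ofPred_eq, exists_prop]
    exact ⟨fun hp => ⟨_, A.center_mem p.base, rfl, hp⟩, fun ⟨_, _, _, hp⟩ => hp⟩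
  rw [this]
  exact Finset.measurableSet_biUnion _ fun c hc => h c hc s hs

open Classical in
theorem measurable_coord : Measurable (A.coord : MultiTangent d n M → Fin n → Eucl d) := by
  refine A.measurable_of_pieces fun c _ s hs => ?_
  have hU : IsOpen ((MultiTangent.base : MultiTangent d n M → M) ⁻¹' (A.U c)) :=
    isOpen_base_preimage (A.isOpen_U c)
  -- Fibre coordinates are continuous only over `U c`; extending by a constant gives a globally
  -- measurable map with the same values on the piece.
  have hc := ((continuousOn_fibreCoord (n := n) c).mono
    (preimage_mono (A.U_subset_source c))).measurable_piecewise (g := fun _ => 0)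
    continuousOn_const hU.measurableSet
  have : {p : MultiTangent d n M | A.center p.base = c} ∩ A.coord ⁻¹' s =
      {p | A.center p.base = c} ∩ (((MultiTangent.base : MultiTangent d n M → M) ⁻¹' (A.U c)).piecewise
        (fibreCoord c) fun _ => 0) ⁻¹' s := by
    ext p
    simp only [mem_inter_iff, mem_ofPred_eq, mem_preimage, and_congr_right_iff]
    rintro rfl
    rw [piecewise_eq_of_mem _ _ _
      (show p ∈ MultiTangent.base ⁻¹' A.U (A.center p.base) from A.mem_U p.base)]
    rfl
  rw [this]
  exact (A.measurableSet_piece c).inter (hc hs)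

open Classical in
theorem measurable_tuple {b : MultiTangent d n M → Fin n → Eucl d} (hb : Measurable b) :
    Measurable fun p => A.tuple p.base (b p) := by
  refine A.measurable_of_pieces fun c _ s hs => ?_
  have hU : IsOpen ((MultiTangent.base : MultiTangent d n M → M) ⁻¹' (A.U c)) :=
    isOpen_base_preimage (A.isOpen_U c)
  have hφ : Measurable (((MultiTangent.base : MultiTangent d n M → M) ⁻¹' (A.U c)).piecewise
      (fun p => extChartAt (𝓡 d) c p.base) fun _ => 0) := by
    refine ContinuousOn.measurable_piecewise ?_ continuousOn_const hU.measurableSet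
    refine (continuousOn_extChartAt (I := 𝓡 d) c).comp
      MultiTangent.continuous_base.continuousOn fun p hp => ?_
    simpa using A.U_subset_source c hp
  have hpar : Measurable ((bundleChartDomain (d := d) c n).piecewise (bundleParam c n)
      fun _ => A.tuple c 0) :=
    (continuousOn_bundleParam c).measurable_piecewise continuousOn_const
      (isOpen_bundleChartDomain c n).measurableSet
  have hcomp := hpar.comp (hφ.prodMk hb)
  have : {p : MultiTangent d n M | A.center p.base = c} ∩ (fun p => A.tuple p.base (b p)) ⁻¹' s =
      {p | A.center p.base = c} ∩ ((bundleChartDomain (d := d) c n).piecewise (bundleParam c n)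
        (fun _ => A.tuple c 0) ∘ fun p =>
          (((MultiTangent.base : MultiTangent d n M → M) ⁻¹' (A.U c)).piecewise
            (fun p => extChartAt (𝓡 d) c p.base) (fun _ => 0) p, b p)) ⁻¹' s := by
    ext p
    simp only [mem_inter_iff, mem_ofPred_eq, mem_preimage, and_congr_right_iff]
    rintro rfl
    rw [Function.comp_apply, piecewise_eq_of_mem _ _ _
      (show p ∈ MultiTangent.base ⁻¹' A.U (A.center p.base) from A.mem_U p.base),
      piecewise_eq_of_mem _ _ _ (mk_mem_bundleChartDomain (A.mem_source p.base) _),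
      bundleParam_extChartAt (A.mem_source p.base)]
    rfl
  rw [this]
  exact (A.measurableSet_piece c).inter (hcomp hs)

/-- A compact set containing the points of `T^n M` with coordinates of norm at most `R`. -/
def box (n : ℕ) (R : ℝ) : Set (MultiTangent d n M) :=
  ⋃ c ∈ A.centers, bundleParam c n ''
    ((extChartAt (𝓡 d) c '' tsupport (A.bump c)) ×ˢ Metric.closedBall 0 R)

theorem isCompact_chartImage (c : M) : IsCompact (extChartAt (𝓡 d) c '' tsupport (A.bump c)) :=
  (A.bump c).hasCompactSupport.image_of_continuousOn
    ((continuousOn_extChartAt c).mono (A.bump c).tsupport_subset_extChartAt_source)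

theorem chartImage_prod_subset (c : M) (s : Set (Fin n → Eucl d)) :
    (extChartAt (𝓡 d) c '' tsupport (A.bump c)) ×ˢ s ⊆ bundleChartDomain c n := by
  rintro ⟨y, w⟩ ⟨⟨x, hx, rfl⟩, -⟩
  exact mk_mem_bundleChartDomain ((A.bump c).tsupport_subset_chartAt_source hx) w

theorem isCompact_box (R : ℝ) : IsCompact (A.box n R) := by
  refine A.centers.isCompact_biUnion fun c _ => ?_
  exact ((A.isCompact_chartImage c).prod (isCompact_closedBall 0 R)).image_of_continuousOn
    ((continuousOn_bundleParam c).mono (A.chartImage_prod_subset c _))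

theorem tuple_mem_box {x : M} {w : Fin n → Eucl d} {R : ℝ} (hw : ‖w‖ ≤ R) :
    A.tuple x w ∈ A.box n R := by
  refine mem_biUnion (A.center_mem x) ⟨(extChartAt (𝓡 d) (A.center x) x, w),
    ⟨⟨x, A.mem_tsupport (A.mem_U x), rfl⟩, by simpa using hw⟩, ?_⟩
  exact bundleParam_extChartAt (A.mem_source x) w

theorem exists_bound {f : MultiTangent d n M → ℝ} (hf : Continuous f) (R : ℝ) :
    ∃ B, 0 ≤ B ∧ ∀ (x : M) (w : Fin n → Eucl d), ‖w‖ ≤ R → |f (A.tuple x w)| ≤ B := by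
  obtain ⟨B, hB⟩ := (A.isCompact_box (n := n) R).exists_bound_of_continuousOn hf.continuousOn
  exact ⟨max B 0, le_max_right _ _, fun x w hw =>
    (hB _ (A.tuple_mem_box hw)).trans (le_max_left _ _)⟩

end ChartCover

/-! ### Vertical derivatives in coordinates. -/

namespace ChartCover

variable [IsManifold (𝓡 d) ∞ M] [T2Space M] {g : SmoothMetric d M} (A : ChartCover g)

/-- The derivative of `f` along the fibre, in the coordinates chosen by the cover. -/
def vderiv (f : MultiTangent d n M → ℝ) (p : MultiTangent d n M) : (Fin n → Eucl d) →L[ℝ] ℝ :=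
  fderiv ℝ (fun w => f (A.tuple p.base w)) (A.coord p)

theorem contDiff_tuple {f : MultiTangent d n M → ℝ} (hf : IsSmoothOnTn f) (x : M) :
    ContDiff ℝ ∞ fun w => f (A.tuple x w) := by
  have h : (fun w => f (A.tuple x w)) = fun w =>
      (f ∘ bundleParam (A.center x) n) (extChartAt (𝓡 d) (A.center x) x, w) := by
    funext w
    rw [Function.comp_apply, bundleParam_extChartAt (A.mem_source x)]
    rfl
  rw [h, ← contDiffOn_univ]
  exact (hf (A.center x)).comp (contDiff_const.prodMk contDiff_id).contDiffOn
    fun w _ => mk_mem_bundleChartDomain (A.mem_source x) w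

theorem differentiable_tuple {f : MultiTangent d n M → ℝ} (hf : IsSmoothOnTn f) (x : M) :
    Differentiable ℝ fun w => f (A.tuple x w) :=
  (A.contDiff_tuple hf x).differentiable (by simp)

theorem hasDerivAt_line {f : MultiTangent d n M → ℝ} (hf : IsSmoothOnTn f)
    (p : MultiTangent d n M) (b : Fin n → Eucl d) :
    HasDerivAt (fun t : ℝ => f (A.tuple p.base (A.coord p + t • b))) (A.vderiv f p b) 0 := by
  have h := (A.differentiable_tuple hf p.base (A.coord p)).hasFDerivAt
  have hl : HasDerivAt (fun t : ℝ => A.coord p + t • b) b 0 := by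
    simpa using ((hasDerivAt_id (0 : ℝ)).smul_const b).const_add (A.coord p)
  exact HasFDerivAt.comp_hasDerivAt_of_eq (0 : ℝ) h hl (by simp)

/-- A pointwise limit of difference quotients with step `1 / (m + 1)`, each of them measurable. -/
theorem measurable_vderiv {f : MultiTangent d n M → ℝ} (hf : IsSmoothOnTn f)
    {b : MultiTangent d n M → Fin n → Eucl d} (hb : Measurable b) :
    Measurable fun p => A.vderiv f p (b p) := by
  have hu : Tendsto (fun m : ℕ => 1 / ((m : ℝ) + 1)) atTop (𝓝[≠] 0) :=
    tendsto_nhdsWithin_iff.2 ⟨tendsto_one_div_add_atTop_nhds_zero_nat,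
      Eventually.of_forall fun m => by simp only [mem_compl_iff, mem_singleton_iff]; positivity⟩
  refine measurable_of_tendsto_metrizable (f := fun (m : ℕ) p =>
    (1 / ((m : ℝ) + 1))⁻¹ • (f (A.tuple p.base (A.coord p + (1 / ((m : ℝ) + 1)) • b p)) - f p))
    (fun m => ?_) (tendsto_pi_nhds.2 fun p => ?_)
  · have h1 := A.measurable_tuple (A.measurable_coord.add (hb.const_smul (1 / ((m : ℝ) + 1))))
    exact ((hf.continuous.measurable.comp h1).sub hf.continuous.measurable).const_mul _
  · have h := (hasDerivAt_iff_tendsto_slope_zero.1 (A.hasDerivAt_line hf p (b p))).comp hu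
    refine h.congr fun m => ?_
    simp only [Function.comp_apply, zero_add, zero_smul, add_zero, A.tuple_coord]

/-- In each of the finitely many charts the fibre derivative is the restriction of the full
derivative of `f ∘ bundleParam c n` to vertical directions, and the latter is bounded on a compact
set. -/
theorem exists_bound_fderiv {f : MultiTangent d n M → ℝ} (hf : IsSmoothOnTn f) (R : ℝ) :
    ∃ B, 0 ≤ B ∧ ∀ (x : M) (w : Fin n → Eucl d), ‖w‖ ≤ R →
      ‖fderiv ℝ (fun w => f (A.tuple x w)) w‖ ≤ B := by
  have hc : ∀ c : M, ∃ B, 0 ≤ B ∧ ∀ x ∈ tsupport (A.bump c), ∀ w : Fin n → Eucl d, ‖w‖ ≤ R →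
      ‖fderiv ℝ (fun w => (f ∘ bundleParam c n) (extChartAt (𝓡 d) c x, w)) w‖ ≤ B := by
    intro c
    have h1 : ContinuousOn (fderiv ℝ (f ∘ bundleParam c n)) (bundleChartDomain c n) :=
      (hf c).continuousOn_fderiv_of_isOpen (isOpen_bundleChartDomain c n) (by simp)
    obtain ⟨B, hB⟩ := ((A.isCompact_chartImage c).prod
      (isCompact_closedBall (0 : Fin n → Eucl d) R)).exists_bound_of_continuousOn
      (h1.mono (A.chartImage_prod_subset c _))
    refine ⟨max B 0, le_max_right _ _, fun x hx w hw => ?_⟩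
    have hB' := hB (extChartAt (𝓡 d) c x, w) ⟨⟨x, hx, rfl⟩, by simpa using hw⟩
    have hdom : (extChartAt (𝓡 d) c x, w) ∈ bundleChartDomain c n :=
      mk_mem_bundleChartDomain ((A.bump c).tsupport_subset_chartAt_source hx) w
    have hd : HasFDerivAt (f ∘ bundleParam c n)
        (fderiv ℝ (f ∘ bundleParam c n) (extChartAt (𝓡 d) c x, w)) (extChartAt (𝓡 d) c x, w) :=
      (((hf c).contDiffAt ((isOpen_bundleChartDomain c n).mem_nhds hdom)).differentiableAt
        (by simp)).hasFDerivAt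
    have hcomp := hd.comp w ((hasFDerivAt_const (extChartAt (𝓡 d) c x) w).prodMk (hasFDerivAt_id w))
    have heq : fderiv ℝ (fun w => (f ∘ bundleParam c n) (extChartAt (𝓡 d) c x, w)) w = _ :=
      hcomp.fderiv
    rw [heq]
    refine ContinuousLinearMap.opNorm_le_bound _ (le_max_right _ _) fun b => ?_
    change ‖fderiv ℝ (f ∘ bundleParam c n) (extChartAt (𝓡 d) c x, w) ((0 : Eucl d), b)‖ ≤ _
    refine (ContinuousLinearMap.le_opNorm _ _).trans ?_
    have hb : ‖((0 : Eucl d), b)‖ ≤ ‖b‖ := by simp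
    exact mul_le_mul (hB'.trans (le_max_left _ _)) hb (norm_nonneg _) (le_max_right _ _)
  choose B hB0 hB using hc
  refine ⟨∑ c ∈ A.centers, B c, Finset.sum_nonneg fun c _ => hB0 c, fun x w hw => ?_⟩
  have h : (fun w => f (A.tuple x w)) = fun w =>
      (f ∘ bundleParam (A.center x) n) (extChartAt (𝓡 d) (A.center x) x, w) := by
    funext w
    rw [Function.comp_apply, bundleParam_extChartAt (A.mem_source x)]
    rfl
  rw [h]
  exact (hB _ x (A.mem_tsupport (A.mem_U x)) w hw).trans
    (Finset.single_le_sum (fun c _ => hB0 c) (A.center_mem x))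

theorem exists_lipschitz {f : MultiTangent d n M → ℝ} (hf : IsSmoothOnTn f) (R : ℝ) :
    ∃ B, 0 ≤ B ∧ ∀ (x : M) (w w' : Fin n → Eucl d), ‖w‖ ≤ R → ‖w'‖ ≤ R →
      |f (A.tuple x w') - f (A.tuple x w)| ≤ B * ‖w' - w‖ := by
  obtain ⟨B, hB0, hB⟩ := A.exists_bound_fderiv hf R
  refine ⟨B, hB0, fun x w w' hw hw' => ?_⟩
  refine (convex_closedBall (0 : Fin n → Eucl d) R).norm_image_sub_le_of_norm_fderiv_le (𝕜 := ℝ)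
    (f := fun w => f (A.tuple x w))
    (fun v _ => A.differentiable_tuple hf x v) (fun v hv => hB x v (by simpa using hv))
    (by simpa using hw) (by simpa using hw')

theorem update_vec_eq (p : MultiTangent d n M) (i : Fin n) (w : TangentSpace (𝓡 d) p.base) (t : ℝ) :
    (⟨p.base, Function.update p.vec i (p.vec i + t • w)⟩ : MultiTangent d n M) =
      A.tuple p.base (A.coord p + t • (Pi.single i (A.coframe p.base w) : Fin n → Eucl d)) := by
  refine MultiTangent.ext_vec fun j => ?_
  change _ = A.frame p.base _
  rcases eq_or_ne j i with rfl | hj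
  · rw [Function.update_self, Pi.add_apply, Pi.smul_apply, Pi.single_eq_same, map_add, map_smul,
      A.frame_coframe]
    exact congrArg (· + t • w) (A.frame_coframe p.base (p.vec j)).symm
  · rw [Function.update_of_ne hj, Pi.add_apply, Pi.smul_apply, Pi.single_eq_of_ne hj, smul_zero,
      add_zero]
    exact (A.frame_coframe p.base (p.vec j)).symm

theorem exists_riesz (g : SmoothMetric d M) (x : M) (l : TangentSpace (𝓡 d) x →ₗ[ℝ] ℝ) :
    ∃ z : TangentSpace (𝓡 d) x, ∀ w, g.inner x w z = l w := by
  have : FiniteDimensional ℝ (TangentSpace (𝓡 d) x) := inferInstanceAs (FiniteDimensional ℝ (Eucl d))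
  let B : TangentSpace (𝓡 d) x →ₗ[ℝ] Module.Dual ℝ (TangentSpace (𝓡 d) x) :=
    { toFun := fun z => (g.inner x z).toLinearMap
      map_add' := fun a b => by rw [map_add]; rfl
      map_smul' := fun a b => by rw [map_smul]; rfl }
  have hinj : Function.Injective B := by
    refine (injective_iff_map_eq_zero B).2 fun z hz => ?_
    by_contra hne
    have h1 := g.pos x z hne
    have h2 : g.inner x z z = 0 := LinearMap.congr_fun hz z
    rw [h2] at h1
    exact lt_irrefl _ h1
  have hsurj := (LinearMap.injective_iff_surjective_of_finrank_eq_finrank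
    (Subspace.dual_finrank_eq (K := ℝ) (V := TangentSpace (𝓡 d) x)).symm).1 hinj
  obtain ⟨z, hz⟩ := hsurj l
  exact ⟨z, fun w => by rw [g.symm]; exact LinearMap.congr_fun hz w⟩

/-- `exists_riesz` provides a gradient at every point, so the default value in `vertGrad` never
occurs. -/
theorem inner_vertGrad {f : MultiTangent d n M → ℝ} (hf : IsSmoothOnTn f)
    (p : MultiTangent d n M) (i : Fin n) (w : Eucl d) :
    g.inner p.base (A.frame p.base w) (vertGrad g f p i) = A.vderiv f p (Pi.single i w) := by
  obtain ⟨z, hz⟩ := exists_riesz g p.base ((A.vderiv f p).toLinearMap ∘ₗ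
    LinearMap.single ℝ (fun _ => Eucl d) i ∘ₗ (A.coframe p.base).toLinearMap)
  have hgrad : IsVertGrad g f p i z := by
    intro v
    rw [hz]
    simp_rw [A.update_vec_eq]
    exact A.hasDerivAt_line hf p _
  rw [hgrad.eq_vertGrad, hz]
  change A.vderiv f p (Pi.single i (A.coframe p.base (A.frame p.base w))) = _
  rw [A.coframe_frame]

/-- The form `θ` at `x` in the coordinates chosen by the cover. -/
def formAt (θ : SmoothForm d n M) (x : M) : Eucl d [⋀^Fin n]→L[ℝ] ℝ :=
  (θ.toFun x).compContinuousLinearMap (A.frame x)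

theorem eval_tuple (θ : SmoothForm d n M) (x : M) (w : Fin n → Eucl d) :
    θ.eval (A.tuple x w) = A.formAt θ x w := rfl

theorem eval_eq (θ : SmoothForm d n M) (p : MultiTangent d n M) :
    θ.eval p = A.formAt θ p.base (A.coord p) := by
  rw [← eval_tuple, tuple_coord]

theorem add_smul_single (w : Fin n → Eucl d) (i : Fin n) (b : Eucl d) (t : ℝ) :
    w + t • (Pi.single i b : Fin n → Eucl d) = Function.update w i (w i + t • b) := by
  funext j
  rcases eq_or_ne j i with rfl | hj
  · simp
  · simp [hj]

/-- Multilinearity leaves no terms of higher order in `t` when only one vector moves. For this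
reason the variation shifts the vectors separately and then averages. -/
theorem eval_tuple_add (θ : SmoothForm d n M) (x : M) (w : Fin n → Eucl d) (i : Fin n) (b : Eucl d)
    (t : ℝ) : θ.eval (A.tuple x (w + t • (Pi.single i b : Fin n → Eucl d))) =
      A.formAt θ x w + t * A.formAt θ x (Function.update w i b) := by
  rw [eval_tuple, add_smul_single, ContinuousAlternatingMap.map_update_add,
    ContinuousAlternatingMap.map_update_smul, Function.update_eq_self]
  rfl

theorem vderiv_eval_single (θ : SmoothForm d n M) (p : MultiTangent d n M) (i : Fin n) (b : Eucl d) :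
    A.vderiv θ.eval p (Pi.single i b) =
      A.formAt θ p.base (Function.update (A.coord p) i b) := by
  have h := A.hasDerivAt_line θ.isSmoothOnTn_eval p (Pi.single i b)
  simp_rw [A.eval_tuple_add] at h
  refine h.unique ?_
  simpa using ((hasDerivAt_id (0 : ℝ)).mul_const
    (A.formAt θ p.base (Function.update (A.coord p) i b))).const_add (A.formAt θ p.base (A.coord p))

theorem vderiv_eq_sum (f : MultiTangent d n M → ℝ) (p : MultiTangent d n M) (b : Fin n → Eucl d) :
    A.vderiv f p b = ∑ i, A.vderiv f p (Pi.single i (b i)) := by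
  conv_lhs => rw [← Finset.univ_sum_single b]
  rw [map_sum]

end ChartCover

/-! ### Absorbing signs into the orientation of basis tuples. -/

section BasisTuple

open Classical in
/-- The tuple `(± e_{I 0}, e_{I 1}, …)`, with the sign of `r`. -/
def signedBasisTuple (I : Fin (k + 1) → Fin d) (r : ℝ) : Fin (k + 1) → Eucl d :=
  if r < 0 then Function.update (basisTuple I) 0 ((-1 : ℝ) • basisTuple I 0) else basisTuple I

theorem measurable_signedBasisTuple (I : Fin (k + 1) → Fin d) : Measurable (signedBasisTuple I) :=
  Measurable.ite measurableSet_Iio measurable_const measurable_const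

theorem norm_signedBasisTuple_le (I : Fin (k + 1) → Fin d) (r : ℝ) : ‖signedBasisTuple I r‖ ≤ 1 := by
  have hb : ∀ i, ‖basisTuple I i‖ ≤ 1 := fun i => by simp [basisTuple]
  refine (pi_norm_le_iff_of_nonneg zero_le_one).2 fun i => ?_
  unfold signedBasisTuple
  split_ifs
  · rcases eq_or_ne i 0 with rfl | hi
    · simpa using hb 0
    · simpa [hi] using hb i
  · exact hb i

/-- Reversing one vector changes the sign of every form, so a signed coefficient can be carried by a
positive density. -/
theorem abs_mul_signedBasisTuple (φ : Eucl d [⋀^Fin (k + 1)]→L[ℝ] ℝ) (I : Fin (k + 1) → Fin d)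
    (r : ℝ) : |r| * φ (signedBasisTuple I r) = r * φ (basisTuple I) := by
  unfold signedBasisTuple
  split_ifs with h
  · rw [ContinuousAlternatingMap.map_update_smul, Function.update_eq_self, abs_of_neg h]
    simp
  · rw [abs_of_nonneg (not_lt.1 h)]

end BasisTuple

/-! ### The truncated shifts of `μ` and the compensating tail measure. -/

namespace ChartCover

variable [IsManifold (𝓡 d) ∞ M] [T2Space M] {g : SmoothMetric d M} (A : ChartCover g)

/-- The `I`-th coordinate of the `n`-vector `∑ i, v₁ ∧ ⋯ ∧ u_i ∧ ⋯ ∧ v_n`. -/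
def multivectorCoord (u : MultiTangent d n M → Fin n → Eucl d) (I : Fin n → Fin d)
    (p : MultiTangent d n M) : ℝ :=
  ∑ i, coordForm I (Function.update (A.coord p) i (u p i))

/-- The derivative of a form along `u` replaces one vector at a time, hence depends on `u` only
through the `n`-vector `∑ v₁ ∧ ⋯ ∧ u_i ∧ ⋯ ∧ v_n`. The factorial is that of `alternating_expansion`.
-/
theorem sum_multivectorCoord (u : MultiTangent d n M → Fin n → Eucl d) (θ : SmoothForm d n M)
    (p : MultiTangent d n M) :
    ∑ I, A.multivectorCoord u I p * A.formAt θ p.base (basisTuple I) =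
      n.factorial * A.vderiv θ.eval p (u p) := by
  rw [A.vderiv_eq_sum, Finset.mul_sum]
  simp_rw [A.vderiv_eval_single, alternating_expansion, multivectorCoord, Finset.sum_mul]
  rw [Finset.sum_comm]

theorem measurable_multivectorCoord {u : MultiTangent d n M → Fin n → Eucl d} (hu : Measurable u)
    (I : Fin n → Fin d) : Measurable (A.multivectorCoord u I) := by
  refine Finset.measurable_sum _ fun i _ => ?_
  refine (coordForm I).cont.measurable.comp ?_
  refine measurable_pi_lambda _ fun j => ?_
  rcases eq_or_ne j i with rfl | hj
  · simpa [Function.comp_def] using (measurable_pi_apply j).comp hu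
  · simpa [hj, Function.comp_def] using (measurable_pi_apply j).comp A.measurable_coord

/-- A vertical vector field `u`, a set `S` on which it is bounded, and a set `P` such that the
contributions of `S` and `P` to the first variation of closedness cancel. -/
structure VariationData (μ : Measure (MultiTangent d (k + 1) M)) where
  u : MultiTangent d (k + 1) M → Fin (k + 1) → Eucl d
  S : Set (MultiTangent d (k + 1) M)
  P : Set (MultiTangent d (k + 1) M)
  R : ℝ
  measurable_u : Measurable u
  measurableSet_S : MeasurableSet S
  norm_coord_le : ∀ p ∈ S, ‖A.coord p‖ ≤ R
  norm_u_le : ∀ p ∈ S, ‖u p‖ ≤ R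
  integrable_multivectorCoord : ∀ I, IntegrableOn (A.multivectorCoord u I) P μ
  orthogonal : ∀ θ : SmoothForm d k M,
    ∫ p in S, A.vderiv θ.dEval p (u p) ∂μ + ∫ p in P, A.vderiv θ.dEval p (u p) ∂μ = 0

namespace VariationData

variable {A} {μ : Measure (MultiTangent d (k + 1) M)} (F : A.VariationData μ)

/-- The field `u` cut off outside of `S`. -/
def w : MultiTangent d (k + 1) M → Fin (k + 1) → Eucl d := F.S.indicator F.u

theorem measurable_w : Measurable F.w := F.measurable_u.indicator F.measurableSet_S

theorem norm_w_le (p : MultiTangent d (k + 1) M) : ‖F.w p‖ ≤ |F.R| := by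
  by_cases hp : p ∈ F.S
  · rw [w, indicator_of_mem hp]
    exact (F.norm_u_le p hp).trans (le_abs_self _)
  · rw [w, indicator_of_notMem hp, norm_zero]
    exact abs_nonneg _

theorem w_eq_zero {p : MultiTangent d (k + 1) M} (hp : p ∉ F.S) : F.w p = 0 :=
  indicator_of_notMem hp _

theorem norm_single_w_le (p : MultiTangent d (k + 1) M) (i : Fin (k + 1)) :
    ‖(Pi.single i (F.w p i) : Fin (k + 1) → Eucl d)‖ ≤ |F.R| := by
  rw [Pi.norm_single]
  exact (norm_le_pi_norm _ i).trans (F.norm_w_le p)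

theorem measurable_single_w (i : Fin (k + 1)) :
    Measurable fun p => (Pi.single i (F.w p i) : Fin (k + 1) → Eucl d) := by
  refine measurable_pi_lambda _ fun j => ?_
  rcases eq_or_ne j i with rfl | hj
  · simpa [Function.comp_def] using (measurable_pi_apply j).comp F.measurable_w
  · simp [hj]

/-- The translation of the `i`-th vector by `s w_i`. -/
def shift (i : Fin (k + 1)) (s : ℝ) (p : MultiTangent d (k + 1) M) : MultiTangent d (k + 1) M :=
  A.tuple p.base (A.coord p + s • (Pi.single i (F.w p i) : Fin (k + 1) → Eucl d))

theorem measurable_shift (i : Fin (k + 1)) (s : ℝ) : Measurable (F.shift i s) :=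
  A.measurable_tuple (A.measurable_coord.add ((F.measurable_single_w i).const_smul s))

theorem shift_zero (i : Fin (k + 1)) (p : MultiTangent d (k + 1) M) : F.shift i 0 p = p := by
  rw [shift, zero_smul, add_zero, A.tuple_coord]

theorem shift_of_notMem (i : Fin (k + 1)) (s : ℝ) {p : MultiTangent d (k + 1) M} (hp : p ∉ F.S) :
    F.shift i s p = p := by
  rw [shift, F.w_eq_zero hp, Pi.zero_apply, Pi.single_zero, smul_zero, add_zero, A.tuple_coord]

/-- On `S` the coordinates and the field are bounded, and off `S` nothing moves. The constant is
uniform in `p`, as needed to differentiate under the integral although `f` itself may be unbounded.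
-/
theorem exists_lipschitz_shift {f : MultiTangent d (k + 1) M → ℝ} (hf : IsSmoothOnTn f) (s₀ : ℝ) :
    ∃ B, 0 ≤ B ∧ ∀ (i : Fin (k + 1)) (p : MultiTangent d (k + 1) M) (s t : ℝ), |s| ≤ s₀ → |t| ≤ s₀ →
      |f (F.shift i s p) - f (F.shift i t p)| ≤ B * |s - t| := by
  obtain ⟨B, hB0, hB⟩ := A.exists_lipschitz hf (|F.R| + s₀ * |F.R|)
  refine ⟨B * |F.R|, by positivity, fun i p s t hs ht => ?_⟩
  by_cases hp : p ∈ F.S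
  · have hn : ∀ r : ℝ, |r| ≤ s₀ →
        ‖A.coord p + r • (Pi.single i (F.w p i) : Fin (k + 1) → Eucl d)‖ ≤ |F.R| + s₀ * |F.R| := by
      intro r hr
      refine (norm_add_le _ _).trans (add_le_add ((F.norm_coord_le p hp).trans (le_abs_self _)) ?_)
      rw [norm_smul, Real.norm_eq_abs]
      exact mul_le_mul hr (F.norm_single_w_le p i) (norm_nonneg _) ((abs_nonneg _).trans hr)
    refine (hB p.base _ _ (hn t ht) (hn s hs)).trans ?_
    rw [add_sub_add_left_eq_sub, ← sub_smul, norm_smul, Real.norm_eq_abs]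
    calc B * (|s - t| * _) ≤ B * (|s - t| * |F.R|) := by
          gcongr
          exact F.norm_single_w_le p i
      _ = _ := by ring
  · rw [F.shift_of_notMem i s hp, F.shift_of_notMem i t hp, sub_self, abs_zero]
    positivity

theorem integrable_shift [IsFiniteMeasure μ] {f : MultiTangent d (k + 1) M → ℝ}
    (hf : IsSmoothOnTn f) (hi : Integrable f μ) (i : Fin (k + 1)) (s : ℝ) :
    Integrable (fun p => f (F.shift i s p)) μ := by
  obtain ⟨B, hB0, hB⟩ := F.exists_lipschitz_shift hf |s|
  have h : Integrable (fun p => f (F.shift i s p) - f p) μ := by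
    refine Integrable.of_bound ((hf.continuous.measurable.comp (F.measurable_shift i s)).sub
      hf.continuous.measurable).aestronglyMeasurable (B * |s|) (Eventually.of_forall fun p => ?_)
    have := hB i p s 0 le_rfl (by simp)
    rwa [F.shift_zero, sub_zero] at this
  exact (h.add hi).congr (Eventually.of_forall fun p => by simp)

theorem hasDerivAt_integral_shift [IsFiniteMeasure μ] {f : MultiTangent d (k + 1) M → ℝ}
    (hf : IsSmoothOnTn f) (hi : Integrable f μ) (i : Fin (k + 1)) :
    HasDerivAt (fun s => ∫ p, f (F.shift i s p) ∂μ)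
      (∫ p, A.vderiv f p (Pi.single i (F.w p i)) ∂μ) 0 := by
  obtain ⟨B, hB0, hB⟩ := F.exists_lipschitz_shift hf 1
  refine (hasDerivAt_integral_of_dominated_loc_of_lip (bound := fun _ => B)
    (Metric.ball_mem_nhds (0 : ℝ) one_pos)
    (Eventually.of_forall fun s =>
      (hf.continuous.measurable.comp (F.measurable_shift i s)).aestronglyMeasurable)
    (F.integrable_shift hf hi i 0)
    (A.measurable_vderiv hf (F.measurable_single_w i)).aestronglyMeasurable
    (Eventually.of_forall fun p => ?_) (integrable_const B)
    (Eventually.of_forall fun p => A.hasDerivAt_line hf p _)).2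
  refine LipschitzOnWith.of_dist_le_mul fun s hs t ht => ?_
  rw [mem_ball_zero_iff] at hs ht
  simpa [Real.dist_eq, abs_of_nonneg hB0] using hB i p s t hs.le ht.le

theorem exists_bound_vderiv {f : MultiTangent d (k + 1) M → ℝ} (hf : IsSmoothOnTn f) :
    ∃ B, 0 ≤ B ∧ ∀ p (b : Fin (k + 1) → Eucl d), p ∈ F.S → |A.vderiv f p b| ≤ B * ‖b‖ := by
  obtain ⟨B, hB0, hB⟩ := A.exists_bound_fderiv hf F.R
  refine ⟨B, hB0, fun p b hp => ?_⟩
  exact (ContinuousLinearMap.le_opNorm _ b).trans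
    (mul_le_mul_of_nonneg_right (hB _ _ (F.norm_coord_le p hp)) (norm_nonneg _))

theorem integrable_vderiv [IsFiniteMeasure μ] {f : MultiTangent d (k + 1) M → ℝ}
    (hf : IsSmoothOnTn f) {b : MultiTangent d (k + 1) M → Fin (k + 1) → Eucl d} (hb : Measurable b)
    (hbS : ∀ p ∉ F.S, b p = 0) (hbR : ∀ p, ‖b p‖ ≤ |F.R|) :
    Integrable (fun p => A.vderiv f p (b p)) μ := by
  obtain ⟨B, hB0, hB⟩ := F.exists_bound_vderiv hf
  refine Integrable.of_bound (A.measurable_vderiv hf hb).aestronglyMeasurable (B * |F.R|)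
    (Eventually.of_forall fun p => ?_)
  by_cases hp : p ∈ F.S
  · exact (hB p _ hp).trans (mul_le_mul_of_nonneg_left (hbR p) hB0)
  · rw [hbS p hp, map_zero, norm_zero]
    positivity

theorem integrable_vderiv_w [IsFiniteMeasure μ] {f : MultiTangent d (k + 1) M → ℝ}
    (hf : IsSmoothOnTn f) : Integrable (fun p => A.vderiv f p (F.w p)) μ :=
  F.integrable_vderiv hf F.measurable_w (fun _ hp => F.w_eq_zero hp) F.norm_w_le

theorem integrable_vderiv_single [IsFiniteMeasure μ] {f : MultiTangent d (k + 1) M → ℝ}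
    (hf : IsSmoothOnTn f) (i : Fin (k + 1)) :
    Integrable (fun p => A.vderiv f p (Pi.single i (F.w p i))) μ :=
  F.integrable_vderiv hf (F.measurable_single_w i)
    (fun p hp => by rw [F.w_eq_zero hp, Pi.zero_apply, Pi.single_zero])
    (fun p => F.norm_single_w_le p i)

theorem sum_integral_vderiv_single [IsFiniteMeasure μ] {f : MultiTangent d (k + 1) M → ℝ}
    (hf : IsSmoothOnTn f) : ∑ i, ∫ p, A.vderiv f p (Pi.single i (F.w p i)) ∂μ =
      ∫ p, A.vderiv f p (F.w p) ∂μ := by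
  rw [← integral_finsetSum _ fun i _ => F.integrable_vderiv_single hf i]
  refine integral_congr_ae (Eventually.of_forall fun p => ?_)
  exact (A.vderiv_eq_sum f p (F.w p)).symm

theorem integral_vderiv_w {f : MultiTangent d (k + 1) M → ℝ} :
    ∫ p, A.vderiv f p (F.w p) ∂μ = ∫ p in F.S, A.vderiv f p (F.u p) ∂μ := by
  rw [← integral_indicator F.measurableSet_S]
  refine integral_congr_ae (Eventually.of_forall fun p => ?_)
  by_cases hp : p ∈ F.S
  · simp [w, hp]
  · simp [w, hp]

/-- An identity for every `s`, not a first-order expansion: it makes the family closed at all times.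
-/
theorem integral_eval_shift [IsFiniteMeasure μ] (θ : SmoothForm d (k + 1) M)
    (hi : Integrable θ.eval μ) (i : Fin (k + 1)) (s : ℝ) :
    ∫ p, θ.eval (F.shift i s p) ∂μ =
      ∫ p, θ.eval p ∂μ + s * ∫ p, A.vderiv θ.eval p (Pi.single i (F.w p i)) ∂μ := by
  rw [← integral_const_mul, ← integral_add hi
    ((F.integrable_vderiv_single θ.isSmoothOnTn_eval i).const_mul s)]
  refine integral_congr_ae (Eventually.of_forall fun p => ?_)
  change θ.eval (A.tuple p.base (A.coord p + s • (Pi.single i (F.w p i) : Fin (k + 1) → Eucl d))) =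
    θ.eval p + s * A.vderiv θ.eval p _
  rw [A.eval_tuple_add, A.vderiv_eval_single, A.eval_eq θ p]

/-- The measure carrying the part of the first variation of closedness coming from `P`. -/
def tail : Measure (MultiTangent d (k + 1) M) :=
  ∑ I : Fin (k + 1) → Fin d,
    ((μ.restrict F.P).withDensity fun p =>
      ENNReal.ofReal (|A.multivectorCoord F.u I p| / (k + 1).factorial)).map
      fun p => A.tuple p.base (signedBasisTuple I (A.multivectorCoord F.u I p))

/-- The mass of `tail`. -/
def tailMass : ℝ := ∑ I : Fin (k + 1) → Fin d,
  ∫ p in F.P, |A.multivectorCoord F.u I p| / (k + 1).factorial ∂μ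

theorem measurable_tailMap (I : Fin (k + 1) → Fin d) : Measurable
    fun p => A.tuple p.base (signedBasisTuple I (A.multivectorCoord F.u I p)) :=
  A.measurable_tuple ((measurable_signedBasisTuple I).comp
    (A.measurable_multivectorCoord F.measurable_u I))

theorem measurable_density (I : Fin (k + 1) → Fin d) : Measurable fun p =>
    ENNReal.ofReal (|A.multivectorCoord F.u I p| / (k + 1).factorial) :=
  ((measurable_abs.comp (A.measurable_multivectorCoord F.measurable_u I)).div_const _).ennreal_ofReal

/-- The tail is carried by signed basis tuples, of norm at most one. Measurability of `h` is not
asked for, so the bound applies directly to `volN`, a supremum over all forms of comass at most one.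
-/
theorem lintegral_tail_le {h : MultiTangent d (k + 1) M → ENNReal} {K : ENNReal}
    (hK : ∀ (x : M) (w : Fin (k + 1) → Eucl d), ‖w‖ ≤ 1 → h (A.tuple x w) ≤ K) :
    ∫⁻ p, h p ∂F.tail ≤ K * F.tail univ := by
  rw [tail, lintegral_finsetSum_measure, Measure.finsetSum_apply, Finset.mul_sum]
  refine Finset.sum_le_sum fun I _ => ?_
  refine (lintegral_map_le _ _).trans ?_
  rw [Measure.map_apply (F.measurable_tailMap I) MeasurableSet.univ, preimage_univ,
    ← lintegral_const]
  exact lintegral_mono fun p => hK _ _ (norm_signedBasisTuple_le _ _)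

theorem tailMass_nonneg : 0 ≤ F.tailMass :=
  Finset.sum_nonneg fun I _ => integral_nonneg fun p => by positivity

theorem tail_univ : F.tail univ = ENNReal.ofReal F.tailMass := by
  rw [tail, Measure.finsetSum_apply, tailMass,
    ENNReal.ofReal_sum_of_nonneg fun I _ => integral_nonneg fun p => by positivity]
  refine Finset.sum_congr rfl fun I _ => ?_
  rw [Measure.map_apply (F.measurable_tailMap I) MeasurableSet.univ, preimage_univ,
    withDensity_apply _ MeasurableSet.univ, Measure.restrict_univ,
    ofReal_integral_eq_lintegral_ofReal ((F.integrable_multivectorCoord I).abs.div_const _)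
      (Eventually.of_forall fun p => by positivity)]

instance : IsFiniteMeasure F.tail := ⟨by rw [tail_univ]; exact ENNReal.ofReal_lt_top⟩

theorem ae_tail_of_tuple {q : MultiTangent d (k + 1) M → Prop} (hq : MeasurableSet {p | q p})
    (h : ∀ (x : M) (w : Fin (k + 1) → Eucl d), ‖w‖ ≤ 1 → q (A.tuple x w)) : ∀ᵐ p ∂F.tail, q p := by
  have h1 := F.lintegral_tail_le (h := indicator {p | q p}ᶜ 1) (K := 0) fun x w hw => by
    simp [h x w hw]
  rw [zero_mul, lintegral_indicator_one hq.compl] at h1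
  exact ae_iff.2 (le_antisymm h1 zero_le)

theorem ae_tail_le {f : MultiTangent d (k + 1) M → ℝ} (hf : Measurable f) {B : ℝ}
    (hB : ∀ (x : M) (w : Fin (k + 1) → Eucl d), ‖w‖ ≤ 1 → |f (A.tuple x w)| ≤ B) :
    ∀ᵐ p ∂F.tail, ‖f p‖ ≤ B :=
  F.ae_tail_of_tuple (measurableSet_le hf.norm measurable_const) hB

theorem integrable_tail {f : MultiTangent d (k + 1) M → ℝ} (hf : Continuous f) :
    Integrable f F.tail := by
  obtain ⟨B, _, hB⟩ := A.exists_bound hf 1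
  exact Integrable.of_bound hf.measurable.aestronglyMeasurable B (F.ae_tail_le hf.measurable hB)

theorem abs_integral_tail_le {f : MultiTangent d (k + 1) M → ℝ} (hf : Measurable f) {B : ℝ}
    (hB : ∀ (x : M) (w : Fin (k + 1) → Eucl d), ‖w‖ ≤ 1 → |f (A.tuple x w)| ≤ B) :
    |∫ p, f p ∂F.tail| ≤ B * F.tailMass := by
  refine (norm_integral_le_of_norm_le_const (F.ae_tail_le hf hB)).trans (le_of_eq ?_)
  rw [Measure.real, tail_univ, ENNReal.toReal_ofReal F.tailMass_nonneg]

/-- As a functional on forms, the tail equals the part of the first variation that the truncation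
discards. Density and orientation together restore the signed coefficients, and the factorial in the
density cancels that of `sum_multivectorCoord`. -/
theorem integral_eval_tail (θ : SmoothForm d (k + 1) M) :
    ∫ p, θ.eval p ∂F.tail = ∫ p in F.P, A.vderiv θ.eval p (F.u p) ∂μ := by
  have hc := θ.isSmoothOnTn_eval.continuous
  have hi := F.integrable_tail hc
  rw [tail] at hi
  rw [tail, integral_finsetSum_measure fun I _ =>
    (integrable_finsetSum_measure.1 hi) I (Finset.mem_univ I)]
  have hterm : ∀ I : Fin (k + 1) → Fin d, ∫ p, θ.eval p ∂(((μ.restrict F.P).withDensity fun p =>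
      ENNReal.ofReal (|A.multivectorCoord F.u I p| / (k + 1).factorial)).map
      fun p => A.tuple p.base (signedBasisTuple I (A.multivectorCoord F.u I p))) =
      ∫ p in F.P, ((k + 1).factorial : ℝ)⁻¹ *
        (A.multivectorCoord F.u I p * A.formAt θ p.base (basisTuple I)) ∂μ := by
    intro I
    rw [integral_map (F.measurable_tailMap I).aemeasurable hc.measurable.aestronglyMeasurable,
      integral_withDensity_eq_integral_toReal_smul (F.measurable_density I)
        (Eventually.of_forall fun p => ENNReal.ofReal_lt_top)]
    refine integral_congr_ae (Eventually.of_forall fun p => ?_)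
    dsimp only
    rw [ENNReal.toReal_ofReal (by positivity), A.eval_tuple, smul_eq_mul, div_mul_eq_mul_div,
      abs_mul_signedBasisTuple, div_eq_inv_mul]
  have hint : ∀ I : Fin (k + 1) → Fin d, Integrable (fun p => ((k + 1).factorial : ℝ)⁻¹ *
        (A.multivectorCoord F.u I p * A.formAt θ p.base (basisTuple I))) (μ.restrict F.P) := by
    intro I
    obtain ⟨B, _, hB⟩ := A.exists_bound hc 1
    refine Integrable.const_mul ?_ _
    refine (F.integrable_multivectorCoord I).mul_bdd (c := B) ?_ (Eventually.of_forall fun p => ?_)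
    · exact (hc.measurable.comp
        (A.measurable_tuple (b := fun _ => basisTuple I) measurable_const)).aestronglyMeasurable
    · have h1 : signedBasisTuple I 0 = basisTuple I := by simp [signedBasisTuple]
      have h2 := norm_signedBasisTuple_le I 0
      rw [h1] at h2
      exact hB p.base _ h2
  rw [Finset.sum_congr rfl fun I _ => hterm I, ← integral_finsetSum _ fun I _ => hint I]
  refine integral_congr_ae (Eventually.of_forall fun p => ?_)
  dsimp only
  rw [← Finset.mul_sum, A.sum_multivectorCoord, ← mul_assoc, inv_mul_cancel₀, one_mul]
  positivity

end VariationData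

end ChartCover

/-! ### Comass estimates and integrability of forms against mild measures. -/

section Mass

variable [IsManifold (𝓡 d) ∞ M]

theorem SmoothMetric.inner_self_nonneg (g : SmoothMetric d M) (x : M) (v : TangentSpace (𝓡 d) x) :
    0 ≤ g.inner x v v := by
  rcases eq_or_ne v 0 with rfl | hv
  · rw [map_zero]
  · exact (g.pos x v hv).le

theorem SmoothForm.eval_smul_vec (θ : SmoothForm d n M) (p : MultiTangent d n M) (a : ℝ) :
    θ.eval ⟨p.base, fun i => a • p.vec i⟩ = a ^ n * θ.eval p := by
  have := (θ.toFun p.base).toMultilinearMap.map_smul_univ (fun _ => a) p.vec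
  simpa [SmoothForm.eval] using this

theorem SmoothMetric.inner_smul_smul (g : SmoothMetric d M) (x : M) (v : TangentSpace (𝓡 d) x)
    (a : ℝ) : g.inner x (a • v) (a • v) = a ^ 2 * g.inner x v v := by
  rw [map_smul, map_smul, smul_apply, smul_eq_mul, smul_eq_mul]
  ring

namespace ChartCover

variable [T2Space M] {g : SmoothMetric d M}

/-- Forms of comass at most one are uniformly bounded on tuples with bounded coordinates. -/
theorem exists_bound_comass (A : ChartCover g) (n : ℕ) (R : ℝ) : ∃ K : ℝ, 0 ≤ K ∧ ∀ θ : SmoothForm d n M,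
    ComassLeOne g θ → ∀ (x : M) (w : Fin n → Eucl d), ‖w‖ ≤ R → θ.eval (A.tuple x w) ≤ K := by
  -- Scaling by `ρ⁻¹` brings the frame vectors into the unit ball: their squared length is at most
  -- `C R² ≤ ρ ≤ ρ²`, which avoids square roots.
  set ρ : ℝ := 1 + A.C * R ^ 2 with hρ
  have hC := A.C_pos
  have hρ1 : 1 ≤ ρ := by rw [hρ]; nlinarith [mul_nonneg hC.le (sq_nonneg R)]
  have hρ0 : 0 < ρ := one_pos.trans_le hρ1
  refine ⟨ρ ^ n, by positivity, fun θ hθ x w hw => ?_⟩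
  have h1 := hθ ⟨x, fun i => ρ⁻¹ • A.frame x (w i)⟩ fun i => by
    rw [SmoothMetric.inner_smul_smul]
    have h2 := A.inner_frame_le x (w i)
    have h3 : ‖w i‖ ≤ R := (norm_le_pi_norm w i).trans hw
    have h4 : A.C * ‖w i‖ ^ 2 ≤ A.C * R ^ 2 := by gcongr
    have h5 : g.inner x (A.frame x (w i)) (A.frame x (w i)) ≤ ρ ^ 2 := by nlinarith
    calc ρ⁻¹ ^ 2 * g.inner x (A.frame x (w i)) (A.frame x (w i)) ≤ ρ⁻¹ ^ 2 * ρ ^ 2 := by gcongr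
      _ = 1 := by rw [← mul_pow, inv_mul_cancel₀ hρ0.ne', one_pow]
  have h6 := SmoothForm.eval_smul_vec θ (A.tuple x w) ρ⁻¹
  have h7 : θ.eval ⟨x, fun i => ρ⁻¹ • A.frame x (w i)⟩ = ρ⁻¹ ^ n * θ.eval (A.tuple x w) := h6
  rw [h7, inv_pow, inv_mul_le_iff₀ (by positivity), mul_one] at h1
  exact h1

/-- By compactness `θ` has finite comass, so `θ` and `-θ`, suitably rescaled, compete in the
supremum defining `volN`. -/
theorem exists_abs_eval_le_volN (A : ChartCover g) (θ : SmoothForm d n M) :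
    ∃ K : ℝ, 0 ≤ K ∧ ∀ p, ENNReal.ofReal |θ.eval p| ≤ ENNReal.ofReal K * volN g p := by
  have hC := A.C_pos
  -- Vectors of `g`-length at most one have coordinates with `‖w‖² ≤ C`, hence `‖w‖ ≤ 1 + C`.
  obtain ⟨B, hB0, hB⟩ := A.exists_bound θ.isSmoothOnTn_eval.continuous (1 + A.C)
  have hbound : ∀ p : MultiTangent d n M, (∀ i, g.inner p.base (p.vec i) (p.vec i) ≤ 1) →
      |θ.eval p| ≤ B + 1 := by
    intro p hp
    rw [← A.tuple_coord p]
    refine (hB _ _ ((pi_norm_le_iff_of_nonneg (by positivity)).2 fun i => ?_)).trans (by linarith)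
    have h1 := A.le_inner_frame p.base (A.coord p i)
    have h2 : A.frame p.base (A.coord p i) = p.vec i := A.frame_coframe p.base (p.vec i)
    rw [h2] at h1
    have h3 : A.C * g.inner p.base (p.vec i) (p.vec i) ≤ A.C * 1 := by gcongr; exact hp i
    nlinarith [norm_nonneg (A.coord p i)]
  have hcom : ∀ a : ℝ, |a| = (B + 1)⁻¹ → ComassLeOne g (a • θ) := by
    intro a ha p hp
    rw [SmoothForm.eval_smul]
    refine (le_abs_self _).trans ?_
    rw [abs_mul, ha, inv_mul_le_iff₀ (by positivity), mul_one]
    exact hbound p hp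
  have hpos : |(B + 1)⁻¹| = (B + 1)⁻¹ := abs_of_pos (by positivity)
  refine ⟨B + 1, by positivity, fun p => ?_⟩
  have hle : ∀ a : ℝ, |a| = (B + 1)⁻¹ → a * θ.eval p = (B + 1)⁻¹ * |θ.eval p| →
      ENNReal.ofReal |θ.eval p| ≤ ENNReal.ofReal (B + 1) * volN g p := by
    intro a ha hap
    have h1 : ENNReal.ofReal ((B + 1)⁻¹ * |θ.eval p|) ≤ volN g p := by
      rw [← hap]
      exact le_iSup₂ (f := fun (θ : SmoothForm d n M) (_ : ComassLeOne g θ) =>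
        ENNReal.ofReal (θ.eval p)) (a • θ) (hcom a ha)
    calc ENNReal.ofReal |θ.eval p|
        = ENNReal.ofReal (B + 1) * ENNReal.ofReal ((B + 1)⁻¹ * |θ.eval p|) := by
          rw [← ENNReal.ofReal_mul (by positivity), ← mul_assoc,
            mul_inv_cancel₀ (by positivity), one_mul]
      _ ≤ _ := by gcongr
  rcases le_total 0 (θ.eval p) with h | h
  · exact hle (B + 1)⁻¹ hpos (by rw [abs_of_nonneg h])
  · exact hle (-(B + 1)⁻¹) (by rw [abs_neg, hpos]) (by rw [abs_of_nonpos h]; ring)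

theorem integrable_eval (A : ChartCover g) {μ : Measure (MultiTangent d n M)} (hμ : IsMild g μ)
    (θ : SmoothForm d n M) : Integrable θ.eval μ := by
  obtain ⟨K, _, hK⟩ := A.exists_abs_eval_le_volN θ
  refine ⟨θ.isSmoothOnTn_eval.continuous.measurable.aestronglyMeasurable, ?_⟩
  rw [hasFiniteIntegral_iff_norm]
  calc ∫⁻ p, ENNReal.ofReal ‖θ.eval p‖ ∂μ ≤ ∫⁻ p, ENNReal.ofReal K * volN g p ∂μ :=
        lintegral_mono hK
    _ = ENNReal.ofReal K * ∫⁻ p, volN g p ∂μ := lintegral_const_mul' _ _ ENNReal.ofReal_ne_top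
    _ < ⊤ := ENNReal.mul_lt_top ENNReal.ofReal_lt_top hμ

end ChartCover

end Mass

/-! ### The one-parameter family of holonomic measures. -/

namespace ChartCover.VariationData

variable [IsManifold (𝓡 d) ∞ M] [T2Space M] {g : SmoothMetric d M} {A : ChartCover g}
  {μ : Measure (MultiTangent d (k + 1) M)} (F : A.VariationData μ)

/-- The variation of `μ` determined by the data. -/
def family (t : ℝ) : Measure (MultiTangent d (k + 1) M) :=
  ENNReal.ofReal (1 / (1 + t * F.tailMass)) •
      (ENNReal.ofReal (1 / (k + 1 : ℕ)) • ∑ i, μ.map (F.shift i ((k + 1 : ℕ) * t))) +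
    ENNReal.ofReal (t / (1 + t * F.tailMass)) • F.tail

theorem one_add_pos {t : ℝ} (ht : 0 ≤ t) : 0 < 1 + t * F.tailMass := by
  have := mul_nonneg ht F.tailMass_nonneg
  linarith

theorem family_zero : F.family 0 = μ := by
  have h : ∀ i, μ.map (F.shift i 0) = μ := by
    intro i
    have : F.shift i 0 = id := funext (F.shift_zero i)
    rw [this, Measure.map_id]
  have h2 : ENNReal.ofReal (1 / (k + 1 : ℕ)) * ((k + 1 : ℕ) : ENNReal) = 1 := by
    rw [← ENNReal.ofReal_natCast, ← ENNReal.ofReal_mul (by positivity), one_div,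
      inv_mul_cancel₀ (by positivity), ENNReal.ofReal_one]
  simp only [family, mul_zero, zero_mul, add_zero, div_one, ENNReal.ofReal_one, one_smul,
    ENNReal.ofReal_zero, zero_smul, h, Finset.sum_const, Finset.card_univ, Fintype.card_fin]
  rw [← Nat.cast_smul_eq_nsmul ENNReal, smul_smul, h2, one_smul]

theorem integrable_family [IsFiniteMeasure μ] {f : MultiTangent d (k + 1) M → ℝ}
    (hf : IsSmoothOnTn f) (hi : Integrable f μ) (t : ℝ) : Integrable f (F.family t) := by
  refine Integrable.add_measure (Integrable.smul_measure (Integrable.smul_measure ?_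
    ENNReal.ofReal_ne_top) ENNReal.ofReal_ne_top)
    ((F.integrable_tail hf.continuous).smul_measure ENNReal.ofReal_ne_top)
  refine integrable_finsetSum_measure.2 fun i _ => ?_
  exact (integrable_map_measure hf.continuous.measurable.aestronglyMeasurable
    (F.measurable_shift i _).aemeasurable).2 (F.integrable_shift hf hi i _)

theorem integral_family [IsFiniteMeasure μ] {f : MultiTangent d (k + 1) M → ℝ}
    (hf : IsSmoothOnTn f) (hi : Integrable f μ) {t : ℝ} (ht : 0 ≤ t) :
    ∫ p, f p ∂(F.family t) = 1 / (1 + t * F.tailMass) *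
      (1 / (k + 1 : ℕ) * ∑ i, ∫ p, f (F.shift i ((k + 1 : ℕ) * t) p) ∂μ) +
      t / (1 + t * F.tailMass) * ∫ p, f p ∂F.tail := by
  have hpos := F.one_add_pos ht
  have hmap : ∀ i, Integrable f (μ.map (F.shift i ((k + 1 : ℕ) * t))) := fun i =>
    (integrable_map_measure hf.continuous.measurable.aestronglyMeasurable
      (F.measurable_shift i _).aemeasurable).2 (F.integrable_shift hf hi i _)
  have hsum := integrable_finsetSum_measure.2 fun i (_ : i ∈ Finset.univ) => hmap i
  rw [family, integral_add_measure
    ((hsum.smul_measure ENNReal.ofReal_ne_top).smul_measure ENNReal.ofReal_ne_top)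
    ((F.integrable_tail hf.continuous).smul_measure ENNReal.ofReal_ne_top),
    integral_smul_measure, integral_smul_measure, integral_smul_measure,
    integral_finsetSum_measure fun i _ => hmap i,
    ENNReal.toReal_ofReal (by positivity), ENNReal.toReal_ofReal (by positivity),
    ENNReal.toReal_ofReal (by positivity)]
  simp only [smul_eq_mul]
  congr 3
  exact Finset.sum_congr rfl fun i _ => integral_map (F.measurable_shift i _).aemeasurable
    hf.continuous.measurable.aestronglyMeasurable

/-- The first variation of the integral of `f`. -/
def firstVariation (f : MultiTangent d (k + 1) M → ℝ) : ℝ :=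
  ∫ p, A.vderiv f p (F.w p) ∂μ - F.tailMass * ∫ p, f p ∂μ + ∫ p, f p ∂F.tail

/-- The speed `k + 1` of each shift cancels the averaging factor, and differentiating the
normalisation produces the term `-tailMass * ∫ f dμ`. -/
theorem hasDerivWithinAt_integral_family [IsFiniteMeasure μ] {f : MultiTangent d (k + 1) M → ℝ}
    (hf : IsSmoothOnTn f) (hi : Integrable f μ) :
    HasDerivWithinAt (fun t => ∫ p, f p ∂(F.family t)) (F.firstVariation f) (Ici 0) 0 := by
  have hk : ((k + 1 : ℕ) : ℝ) ≠ 0 := by positivity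
  have h1 : HasDerivAt (fun t : ℝ => 1 / (1 + t * F.tailMass)) (-F.tailMass) 0 := by
    have h : HasDerivAt (fun t : ℝ => 1 + t * F.tailMass) F.tailMass 0 := by
      simpa using ((hasDerivAt_id (0 : ℝ)).mul_const F.tailMass).const_add 1
    refine ((h.inv (by simp)).congr_deriv (by simp)).congr_of_eventuallyEq
      (Eventually.of_forall fun t => ?_)
    simp
  have h2 : HasDerivAt (fun t : ℝ => t / (1 + t * F.tailMass)) 1 0 := by
    have h := (hasDerivAt_id (0 : ℝ)).mul h1
    refine (h.congr_deriv (by simp)).congr_of_eventuallyEq (Eventually.of_forall fun t => ?_)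
    simp [div_eq_mul_inv]
  have h3 : ∀ i, HasDerivAt (fun t : ℝ => ∫ p, f (F.shift i ((k + 1 : ℕ) * t) p) ∂μ)
      ((∫ p, A.vderiv f p (Pi.single i (F.w p i)) ∂μ) * (k + 1 : ℕ)) 0 := by
    intro i
    have hl : HasDerivAt (fun t : ℝ => ((k + 1 : ℕ) : ℝ) * t) (k + 1 : ℕ) 0 := by
      simpa using (hasDerivAt_id (0 : ℝ)).const_mul ((k + 1 : ℕ) : ℝ)
    exact HasDerivAt.comp_of_eq (0 : ℝ) (F.hasDerivAt_integral_shift hf hi i) hl (by simp)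
  have h4 := (HasDerivAt.fun_sum fun i (_ : i ∈ Finset.univ) => h3 i).const_mul
    (1 / ((k + 1 : ℕ) : ℝ))
  have h5 := (h1.mul h4).add (h2.mul_const (∫ p, f p ∂F.tail))
  refine ((h5.congr_deriv ?_).hasDerivWithinAt (s := Ici 0)).congr
    (fun t ht => F.integral_family hf hi ht) (F.integral_family hf hi le_rfl)
  rw [← Finset.sum_mul, F.sum_integral_vderiv_single hf, firstVariation]
  have h6 : ∀ i, ∫ p, f (F.shift i 0 p) ∂μ = ∫ p, f p ∂μ := by
    intro i
    simp_rw [F.shift_zero]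
  simp only [mul_zero, zero_mul, add_zero, div_one, one_mul, h6, Finset.sum_const,
    Finset.card_univ, Fintype.card_fin, nsmul_eq_mul]
  field_simp
  ring

/-- A shift alters `volN` only on `S`, where the shifted coordinates are bounded and so is `volN`;
on the tail it is bounded outright. -/
theorem isMild_family (hμ : IsMild g μ) [IsFiniteMeasure μ] (t : ℝ) : IsMild g (F.family t) := by
  have hshift : ∀ (i : Fin (k + 1)) (s : ℝ),
      ∫⁻ p, volN g p ∂(μ.map (F.shift i s)) < (⊤ : ENNReal) := by
    intro i s
    obtain ⟨K, hK0, hK⟩ := A.exists_bound_comass (k + 1) (|F.R| + |s| * |F.R|)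
    have hle : ∀ p, volN g (F.shift i s p) ≤ volN g p + ENNReal.ofReal K := by
      intro p
      by_cases hp : p ∈ F.S
      · refine le_trans ?_ le_add_self
        refine iSup₂_le fun θ hθ => ENNReal.ofReal_le_ofReal (hK θ hθ _ _ ?_)
        refine (norm_add_le _ _).trans (add_le_add ((F.norm_coord_le p hp).trans (le_abs_self _)) ?_)
        rw [norm_smul, Real.norm_eq_abs]
        exact mul_le_mul_of_nonneg_left (F.norm_single_w_le p i) (abs_nonneg _)
      · rw [F.shift_of_notMem i s hp]
        exact le_self_add
    calc ∫⁻ p, volN g p ∂(μ.map (F.shift i s)) ≤ ∫⁻ p, volN g (F.shift i s p) ∂μ :=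
          lintegral_map_le _ _
      _ ≤ ∫⁻ p, (volN g p + ENNReal.ofReal K) ∂μ := lintegral_mono hle
      _ = ∫⁻ p, volN g p ∂μ + ∫⁻ _, ENNReal.ofReal K ∂μ := lintegral_add_right _ measurable_const
      _ < ⊤ := by
          rw [lintegral_const]
          exact ENNReal.add_lt_top.2
            ⟨hμ, ENNReal.mul_lt_top ENNReal.ofReal_lt_top (measure_lt_top _ _)⟩
  obtain ⟨K, hK0, hK⟩ := A.exists_bound_comass (k + 1) 1
  have htail : ∫⁻ p, volN g p ∂F.tail < (⊤ : ENNReal) := by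
    refine (F.lintegral_tail_le (K := ENNReal.ofReal K) fun x w hw => ?_).trans_lt
      (ENNReal.mul_lt_top ENNReal.ofReal_lt_top (measure_lt_top _ _))
    exact iSup₂_le fun θ hθ => ENNReal.ofReal_le_ofReal (hK θ hθ x w hw)
  rw [IsMild, family, lintegral_add_measure, lintegral_smul_measure, lintegral_smul_measure,
    lintegral_smul_measure, lintegral_finsetSum_measure]
  refine ENNReal.add_lt_top.2 ⟨ENNReal.mul_lt_top ENNReal.ofReal_lt_top
    (ENNReal.mul_lt_top ENNReal.ofReal_lt_top ?_), ENNReal.mul_lt_top ENNReal.ofReal_lt_top htail⟩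
  exact ENNReal.sum_lt_top.2 fun i _ => hshift i _

theorem isProbabilityMeasure_family [IsProbabilityMeasure μ] {t : ℝ} (ht : 0 ≤ t) :
    IsProbabilityMeasure (F.family t) := by
  have hpos := F.one_add_pos ht
  have hm := F.tailMass_nonneg
  refine ⟨?_⟩
  simp only [family, Measure.add_apply, Measure.smul_apply, smul_eq_mul, Measure.finsetSum_apply,
    Measure.map_apply (F.measurable_shift _ _) MeasurableSet.univ, preimage_univ, measure_univ,
    F.tail_univ, Finset.sum_const, Finset.card_univ, Fintype.card_fin, nsmul_eq_mul, mul_one]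
  rw [← ENNReal.ofReal_natCast, ← ENNReal.ofReal_mul (by positivity),
    ← ENNReal.ofReal_mul (by positivity), ← ENNReal.ofReal_mul (by positivity),
    ← ENNReal.ofReal_add (by positivity) (by positivity), ← ENNReal.ofReal_one]
  congr 1
  have hk : ((k + 1 : ℕ) : ℝ) ≠ 0 := by positivity
  field_simp

/-- Up to normalisation, an exact form integrates to `t` times the contribution of `S` from the
shifts plus `t` times that of `P` from the tail, and these cancel by `orthogonal`. -/
theorem isHolonomic_family (hμ : IsHolonomic g μ) {t : ℝ} (ht : 0 ≤ t) :
    IsHolonomic g (F.family t) := by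
  have := hμ.prob
  refine ⟨F.isProbabilityMeasure_family ht, F.isMild_family hμ.mild t, fun θ => ?_⟩
  have hi := A.integrable_eval hμ.mild θ.extD
  have hk : ((k + 1 : ℕ) : ℝ) ≠ 0 := by positivity
  have horth := F.orthogonal θ
  have h0 : ∫ p, θ.extD.eval p ∂μ = 0 := hμ.closed θ
  have h1 : ∫ p, θ.extD.eval p ∂F.tail = ∫ p in F.P, A.vderiv θ.dEval p (F.u p) ∂μ :=
    F.integral_eval_tail θ.extD
  have h2 := F.sum_integral_vderiv_single θ.extD.isSmoothOnTn_eval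
  rw [F.integral_vderiv_w, θ.eval_extD] at h2
  change ∫ p, θ.extD.eval p ∂(F.family t) = 0
  rw [F.integral_family θ.extD.isSmoothOnTn_eval hi ht, h1]
  simp_rw [F.integral_eval_shift θ.extD hi, h0, zero_add]
  rw [← Finset.mul_sum, θ.eval_extD, h2]
  have h3 : ∫ p in F.P, A.vderiv θ.dEval p (F.u p) ∂μ =
      - ∫ p in F.S, A.vderiv θ.dEval p (F.u p) ∂μ := by linarith
  rw [h3]
  field_simp
  ring

end ChartCover.VariationData

/-! ### Partitions of unity and summability. -/

section PartitionOfUnity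

variable [IsManifold (𝓡 d) ∞ M]

theorem TestFn.continuous (f : TestFn d n M) : Continuous f.1 := f.2.1.continuous

theorem TestFn.integrable (f : TestFn d n M) (ρ : Measure (MultiTangent d n M)) [IsFiniteMeasure ρ] :
    Integrable f.1 ρ :=
  (TestFn.continuous f).integrable_of_hasCompactSupport f.2.2

theorem IsPartitionOfUnity.sum_le_one {ψ : ℕ → TestFn d n M} (hψ : IsPartitionOfUnity ψ)
    (s : Finset ℕ) (p : MultiTangent d n M) : ∑ i ∈ s, (ψ i).1 p ≤ 1 := by
  classical
  have hfin : (Function.support fun i => (ψ i).1 p).Finite := hψ.locallyFinite.point_finite p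
  rw [← hψ.sum_eq_one p, finsum_eq_sum_of_support_subset (s := s ∪ hfin.toFinset) _
    (fun i hi => by simp only [Finset.coe_union, Finite.coe_toFinset]; exact Or.inr hi)]
  exact Finset.sum_le_sum_of_subset_of_nonneg Finset.subset_union_left
    fun i _ _ => hψ.nonneg i p

/-- All partial sums are dominated by `∫ |θ| dρ`, because `ψ` is nonnegative with sum one. -/
theorem IsPartitionOfUnity.summable_integral {ψ : ℕ → TestFn d n M} (hψ : IsPartitionOfUnity ψ)
    (θ : SmoothForm d n M) {ρ : Measure (MultiTangent d n M)} [IsFiniteMeasure ρ]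
    (hi : Integrable θ.eval ρ) :
    Summable fun i => |∫ p, (TestFn.mulForm (ψ i) θ).1 p ∂ρ| := by
  refine summable_of_sum_le (c := ∫ p, |θ.eval p| ∂ρ) (fun i => abs_nonneg _) fun s => ?_
  calc ∑ i ∈ s, |∫ p, (TestFn.mulForm (ψ i) θ).1 p ∂ρ|
      ≤ ∑ i ∈ s, ∫ p, |(TestFn.mulForm (ψ i) θ).1 p| ∂ρ :=
        Finset.sum_le_sum fun i _ => abs_integral_le_integral_abs
    _ = ∫ p, ∑ i ∈ s, |(TestFn.mulForm (ψ i) θ).1 p| ∂ρ :=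
        (integral_finsetSum _ fun i _ => (TestFn.integrable (TestFn.mulForm (ψ i) θ) ρ).abs).symm
    _ ≤ ∫ p, |θ.eval p| ∂ρ := by
        refine integral_mono (integrable_finsetSum _ fun i _ =>
          (TestFn.integrable (TestFn.mulForm (ψ i) θ) ρ).abs) hi.abs fun p => ?_
        have h1 : ∀ i, |(TestFn.mulForm (ψ i) θ).1 p| = (ψ i).1 p * |θ.eval p| := fun i => by
          change |(ψ i).1 p * θ.eval p| = _
          rw [abs_mul, abs_of_nonneg (hψ.nonneg i p)]
        dsimp only
        rw [Finset.sum_congr rfl fun i _ => h1 i, ← Finset.sum_mul]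
        exact mul_le_of_le_one_left (abs_nonneg _) (hψ.sum_le_one s p)

end PartitionOfUnity

/-! ### The first variation as a mild distribution. -/

namespace ChartCover

variable [IsManifold (𝓡 d) ∞ M] [T2Space M] {g : SmoothMetric d M} (A : ChartCover g)

theorem continuous_tuple (x : M) : Continuous (A.tuple x : (Fin n → Eucl d) → MultiTangent d n M) :=
  (continuousOn_frameTuple (A.center x)).comp_continuous (f := fun w => (x, w)) (by fun_prop)
    fun _ => ⟨A.mem_source x, mem_univ _⟩

theorem vderiv_eq_zero {f : MultiTangent d n M → ℝ} {p : MultiTangent d n M}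
    (hp : p ∉ tsupport f) : A.vderiv f p = 0 := by
  have hev : (fun w => f (A.tuple p.base w)) =ᶠ[𝓝 (A.coord p)] fun _ => 0 := by
    have hc := (A.continuous_tuple (n := n) p.base).tendsto (A.coord p)
    rw [A.tuple_coord] at hc
    filter_upwards [hc.eventually ((isClosed_tsupport f).isOpen_compl.mem_nhds hp)] with w hw
    exact image_eq_zero_of_notMem_tsupport hw
  rw [vderiv, hev.fderiv_eq]
  simp

theorem vderiv_add {f h : MultiTangent d n M → ℝ} (hf : IsSmoothOnTn f) (hh : IsSmoothOnTn h)
    (p : MultiTangent d n M) : A.vderiv (f + h) p = A.vderiv f p + A.vderiv h p :=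
  fderiv_add (A.differentiable_tuple hf p.base _) (A.differentiable_tuple hh p.base _)

theorem vderiv_smul {f : MultiTangent d n M → ℝ} (hf : IsSmoothOnTn f) (a : ℝ)
    (p : MultiTangent d n M) : A.vderiv (a • f) p = a • A.vderiv f p :=
  fderiv_const_smul (A.differentiable_tuple hf p.base _) a

/-- The chosen frame is discontinuous across pieces, but it comes from finitely many charts, each
with continuous transition to the chart at `x₀` on a compact set. -/
theorem exists_bound_transition {x₀ : M} {Q : Set M} (hQ : IsCompact Q)
    (hQs : Q ⊆ (chartAt (Eucl d) x₀).source) (n : ℕ) (R : ℝ) :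
    ∃ B, 0 ≤ B ∧ ∀ x ∈ Q, ∀ w : Fin n → Eucl d, ‖w‖ ≤ R →
      ‖fibreCoord x₀ (A.tuple x w)‖ ≤ B := by
  have hc : ∀ c : M, ∃ B, 0 ≤ B ∧ ∀ x ∈ Q, x ∈ tsupport (A.bump c) → ∀ w : Fin n → Eucl d,
      ‖w‖ ≤ R → ‖fibreCoord x₀ (frameTuple c x w)‖ ≤ B := by
    intro c
    have hK : IsCompact ((Q ∩ tsupport (A.bump c)) ×ˢ
        Metric.closedBall (0 : Fin n → Eucl d) R) :=
      (hQ.inter_right (isClosed_tsupport _)).prod (isCompact_closedBall 0 R)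
    have h1 : ContinuousOn (fun q : M × (Fin n → Eucl d) => frameTuple c q.1 q.2)
        ((Q ∩ tsupport (A.bump c)) ×ˢ Metric.closedBall 0 R) :=
      (continuousOn_frameTuple c).mono fun q hq =>
        ⟨(A.bump c).tsupport_subset_chartAt_source hq.1.2, mem_univ _⟩
    have h2 := (continuousOn_fibreCoord (n := n) x₀).comp h1 fun q hq => hQs hq.1.1
    obtain ⟨B, hB⟩ := hK.exists_bound_of_continuousOn h2
    exact ⟨max B 0, le_max_right _ _, fun x hx hxc w hw =>
      (hB (x, w) ⟨⟨hx, hxc⟩, by simpa using hw⟩).trans (le_max_left _ _)⟩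
  choose B hB0 hB using hc
  refine ⟨∑ c ∈ A.centers, B c, Finset.sum_nonneg fun c _ => hB0 c, fun x hx w hw => ?_⟩
  exact (hB _ x hx (A.mem_tsupport (A.mem_U x)) w hw).trans
    (Finset.single_le_sum (fun c _ => hB0 c) (A.center_mem x))

/-- The vertical derivative in an arbitrary bundle chart. -/
theorem vderiv_bundleParam {f : MultiTangent d n M → ℝ} (hf : IsSmoothOnTn f) {x₀ : M}
    {z : Eucl d × (Fin n → Eucl d)} (hz : z ∈ bundleChartDomain x₀ n) (b : Fin n → Eucl d) :
    A.vderiv f (bundleParam x₀ n z) b = fderiv ℝ (f ∘ bundleParam x₀ n) z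
      (0, fibreCoord x₀ (A.tuple ((extChartAt (𝓡 d) x₀).symm z.1) b)) := by
  set x := (extChartAt (𝓡 d) x₀).symm z.1 with hx
  have hxs : x ∈ (chartAt (Eucl d) x₀).source := symm_mem_source hz.1
  have hzx : extChartAt (𝓡 d) x₀ x = z.1 := (extChartAt (𝓡 d) x₀).right_inv hz.1
  have hd : HasFDerivAt (f ∘ bundleParam x₀ n) (fderiv ℝ (f ∘ bundleParam x₀ n) z) z :=
    (((hf x₀).contDiffAt ((isOpen_bundleChartDomain x₀ n).mem_nhds hz)).differentiableAt
      (by simp)).hasFDerivAt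
  set b' := fibreCoord x₀ (A.tuple x b) with hb'
  have hl : HasDerivAt (fun t : ℝ => z + t • ((0 : Eucl d), b')) ((0 : Eucl d), b') 0 := by
    simpa using ((hasDerivAt_id (0 : ℝ)).smul_const ((0 : Eucl d), b')).const_add z
  have h1 := HasFDerivAt.comp_hasDerivAt_of_eq (0 : ℝ) hd hl (by simp)
  have hp : bundleParam x₀ n z = frameTuple x₀ x z.2 := bundleParam_eq_frameTuple hz
  have h2 := A.hasDerivAt_line hf (frameTuple x₀ x z.2) b
  rw [hp]
  refine h2.unique (h1.congr_of_eventuallyEq (Eventually.of_forall fun t => ?_))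
  change f _ = f (bundleParam x₀ n (z + t • ((0 : Eucl d), b')))
  have hzt : z + t • ((0 : Eucl d), b') = (extChartAt (𝓡 d) x₀ x, z.2 + t • b') := by
    ext1
    · simpa using hzx.symm
    · simp
  rw [hzt, bundleParam_extChartAt hxs]
  refine congrArg f (MultiTangent.ext_vec fun i => ?_)
  change A.frame x (A.coframe x (chartFrame x₀ x (z.2 i)) + t • b i) =
    chartFrame x₀ x (z.2 i + t • chartCoframe x₀ x (A.frame x (b i)))
  rw [map_add, map_add, map_smul, map_smul, A.frame_coframe, chartFrame_chartCoframe hxs]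

namespace VariationData

variable {A} {μ : Measure (MultiTangent d (k + 1) M)} (F : A.VariationData μ)

/-- The first variation, as a functional on test functions. -/
def distribution [IsFiniteMeasure μ] : TestFn d (k + 1) M →ₗ[ℝ] ℝ where
  toFun f := F.firstVariation f.1
  map_add' f h := by
    change F.firstVariation (f.1 + h.1) = _
    have h1 : ∀ p, A.vderiv (f.1 + h.1) p (F.w p) =
        A.vderiv f.1 p (F.w p) + A.vderiv h.1 p (F.w p) := fun p => by
      rw [A.vderiv_add f.2.1 h.2.1]
      rfl
    simp only [firstVariation, h1, Pi.add_apply]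
    rw [integral_add (F.integrable_vderiv_w f.2.1) (F.integrable_vderiv_w h.2.1),
      integral_add (TestFn.integrable f μ) (TestFn.integrable h μ),
      integral_add (TestFn.integrable f F.tail) (TestFn.integrable h F.tail)]
    ring
  map_smul' a f := by
    change F.firstVariation (a • f.1) = _
    have h1 : ∀ p, A.vderiv (a • f.1) p (F.w p) = a * A.vderiv f.1 p (F.w p) := fun p => by
      rw [A.vderiv_smul f.2.1]
      rfl
    simp only [firstVariation, h1, Pi.smul_apply, smul_eq_mul, integral_const_mul, RingHom.id_apply]
    ring

/-- The functional has order at most one: two integrals against finite measures, and one vertical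
derivative along the bounded field `w`, whose components in the chart at `x₀` are controlled by
`exists_bound_transition`. -/
theorem isDistribution [IsFiniteMeasure μ] : IsDistribution F.distribution := by
  intro x₀ K hK hKs
  have hQ : IsCompact ((fun z : Eucl d × (Fin (k + 1) → Eucl d) =>
      (extChartAt (𝓡 d) x₀).symm z.1) '' K) :=
    hK.image_of_continuousOn ((continuousOn_extChartAt_symm x₀).comp continuousOn_fst
      fun z hz => (hKs hz).1)
  obtain ⟨B₀, hB₀, hB⟩ := A.exists_bound_transition (x₀ := x₀) hQ
    (by rintro _ ⟨z, hz, rfl⟩; exact symm_mem_source (hKs hz).1) (k + 1) |F.R|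
  refine ⟨1, B₀ * μ.real univ + F.tailMass * μ.real univ + F.tailMass, fun f hf B hB0 hfB => ?_⟩
  have hval : ∀ p, |f.1 p| ≤ B := by
    intro p
    by_cases hp : p ∈ tsupport f.1
    · obtain ⟨z, hz, rfl⟩ := hf hp
      simpa using hfB 0 (by simp) z hz
    · rw [image_eq_zero_of_notMem_tsupport hp, abs_zero]
      exact hB0
  have hder : ∀ p, |A.vderiv f.1 p (F.w p)| ≤ B₀ * B := by
    intro p
    by_cases hp : p ∈ tsupport f.1
    · obtain ⟨z, hz, rfl⟩ := hf hp
      rw [A.vderiv_bundleParam f.2.1 (hKs hz), mul_comm B₀ B]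
      refine ((fderiv ℝ (f.1 ∘ bundleParam x₀ (k + 1)) z).le_opNorm _).trans ?_
      have h1 := hfB 1 le_rfl z hz
      rw [norm_iteratedFDeriv_one] at h1
      refine mul_le_mul h1 ?_ (norm_nonneg _) hB0
      have h2 := hB _ ⟨z, hz, rfl⟩ (F.w (bundleParam x₀ (k + 1) z)) (F.norm_w_le _)
      rw [Prod.norm_def, norm_zero]
      exact max_le hB₀ h2
    · rw [A.vderiv_eq_zero hp]
      simpa using mul_nonneg hB₀ hB0
  have e1 : |∫ p, A.vderiv f.1 p (F.w p) ∂μ| ≤ B₀ * B * μ.real univ :=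
    norm_integral_le_of_norm_le_const (f := fun p => A.vderiv f.1 p (F.w p))
      (Eventually.of_forall hder)
  have e2 : |∫ p, f.1 p ∂μ| ≤ B * μ.real univ :=
    norm_integral_le_of_norm_le_const (f := f.1) (Eventually.of_forall hval)
  have e3 : |∫ p, f.1 p ∂F.tail| ≤ B * F.tailMass :=
    F.abs_integral_tail_le (TestFn.continuous f).measurable fun x w _ => hval _
  have e4 : |F.tailMass * ∫ p, f.1 p ∂μ| ≤ F.tailMass * (B * μ.real univ) := by
    rw [abs_mul, abs_of_nonneg F.tailMass_nonneg]
    exact mul_le_mul_of_nonneg_left e2 F.tailMass_nonneg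
  calc |F.distribution f| ≤ |∫ p, A.vderiv f.1 p (F.w p) ∂μ| + |F.tailMass * ∫ p, f.1 p ∂μ| +
        |∫ p, f.1 p ∂F.tail| := (abs_add_le _ _).trans (add_le_add_left (abs_sub _ _) _)
    _ ≤ B₀ * B * μ.real univ + F.tailMass * (B * μ.real univ) + B * F.tailMass := by gcongr
    _ = _ := by ring

/-- The derivative term lives on the compact `box`, which meets only finitely many supports of the
partition. The other two terms come from finite measures against which forms are integrable. -/
theorem isMildDistribution [IsFiniteMeasure μ] (hμ : IsMild g μ) :
    IsMildDistribution F.distribution := by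
  refine ⟨F.isDistribution, fun ψ hψ θ => ?_⟩
  have hb := hψ.summable_integral θ (A.integrable_eval hμ θ)
  have hc := hψ.summable_integral θ (F.integrable_tail θ.isSmoothOnTn_eval.continuous)
  have ha : Summable fun i => |∫ p, A.vderiv (TestFn.mulForm (ψ i) θ).1 p (F.w p) ∂μ| := by
    have hfin := hψ.locallyFinite.closure.finite_nonempty_inter_compact
      (A.isCompact_box (n := k + 1) F.R)
    refine summable_of_hasFiniteSupport (hfin.subset fun i hi => ?_)
    by_contra hne
    refine hi ?_
    rw [abs_eq_zero]
    refine integral_eq_zero_of_ae (Eventually.of_forall fun p => ?_)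
    by_cases hp : p ∈ F.S
    · have hpb : p ∈ A.box (k + 1) F.R := by
        rw [← A.tuple_coord p]
        exact A.tuple_mem_box (F.norm_coord_le p hp)
      have hpt : p ∉ tsupport (TestFn.mulForm (ψ i) θ).1 := fun h =>
        hne ⟨p, tsupport_mul_subset_left h, hpb⟩
      simp only [A.vderiv_eq_zero hpt]
      rfl
    · simp only [F.w_eq_zero hp, map_zero]
      rfl
  refine Summable.of_nonneg_of_le (fun i => abs_nonneg _) (fun i => ?_)
    ((ha.add (hb.mul_left F.tailMass)).add hc)
  refine (abs_add_le _ _).trans (add_le_add_left ((abs_sub _ _).trans (add_le_add_right ?_ _)) _)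
  rw [abs_mul, abs_of_nonneg F.tailMass_nonneg]

theorem isVariation (hμ : IsHolonomic g μ) : IsVariation g μ F.family := by
  have := hμ.prob
  exact ⟨fun t ht => F.isHolonomic_family hμ ht, F.family_zero, F.distribution,
    F.isMildDistribution hμ.mild,
    fun f => F.hasDerivWithinAt_integral_family f.2.1 (TestFn.integrable f μ)⟩

theorem firstVariation_nonneg (hμ : IsHolonomic g μ) {L : MultiTangent d (k + 1) M → ℝ}
    (hL : IsSmoothOnTn L) (hcrit : IsCritical g L μ) : 0 ≤ F.firstVariation L := by
  have := hμ.prob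
  exact hcrit.2 F.family (F.isVariation hμ) (fun t _ => F.integrable_family hL hcrit.1 t) _
    (F.hasDerivWithinAt_integral_family hL hcrit.1)

end VariationData

end ChartCover

/-! ### The Hilbert space in coordinates. -/

section Comparison

variable [IsManifold (𝓡 d) ∞ M]

theorem SmoothMetric.inner_sq_le (g : SmoothMetric d M) (x : M) (v w : TangentSpace (𝓡 d) x) :
    g.inner x v w ^ 2 ≤ g.inner x v v * g.inner x w w := by
  let B : LinearMap.BilinForm ℝ (TangentSpace (𝓡 d) x) :=
    { toFun := fun z => (g.inner x z).toLinearMap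
      map_add' := fun a b => by rw [map_add]; rfl
      map_smul' := fun a b => by rw [map_smul]; rfl }
  have h : g.inner x v w * g.inner x w v ≤ g.inner x v v * g.inner x w w :=
    B.apply_mul_apply_le_of_forall_zero_le (fun z => SmoothMetric.inner_self_nonneg g x z) v w
  rwa [g.symm x w v, ← sq] at h

end Comparison

/-- Elements of `(ℝ^d)^n` as a Euclidean space. -/
abbrev FibreSpace (d n : ℕ) : Type := EuclideanSpace ℝ (Fin n × Fin d)

/-- The tuple of vectors with given coordinates. -/
def FibreSpace.toTuple (w : FibreSpace d n) : Fin n → Eucl d :=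
  fun i => WithLp.toLp 2 fun j => w (i, j)

theorem FibreSpace.measurable_toTuple :
    Measurable (FibreSpace.toTuple : FibreSpace d n → Fin n → Eucl d) := by
  refine Continuous.measurable (continuous_pi fun i => ?_)
  refine (PiLp.continuous_toLp 2 _).comp (continuous_pi fun j => ?_)
  fun_prop

namespace ChartCover

variable [IsManifold (𝓡 d) ∞ M] [T2Space M] {g : SmoothMetric d M} (A : ChartCover g)

/-- The vertical differential in coordinates. -/
def grad (f : MultiTangent d n M → ℝ) (p : MultiTangent d n M) : FibreSpace d n :=
  WithLp.toLp 2 fun ij => A.vderiv f p (Pi.single ij.1 (EuclideanSpace.single ij.2 1))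

theorem grad_apply (f : MultiTangent d n M → ℝ) (p : MultiTangent d n M) (ij : Fin n × Fin d) :
    A.grad f p ij = A.vderiv f p (Pi.single ij.1 (EuclideanSpace.single ij.2 1)) := rfl

theorem sum_mul_vderiv_single (f : MultiTangent d n M → ℝ) (p : MultiTangent d n M) (i : Fin n)
    (a : Eucl d) : A.vderiv f p (Pi.single i a) =
      ∑ j, a j * A.vderiv f p (Pi.single i (EuclideanSpace.single j 1)) := by
  have h := (EuclideanSpace.basisFun (Fin d) ℝ).sum_repr a
  have h' : a = ∑ j, a j • EuclideanSpace.single j (1 : ℝ) := by simpa using h.symm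
  let l : Eucl d →ₗ[ℝ] ℝ := (A.vderiv f p).toLinearMap ∘ₗ LinearMap.single ℝ (fun _ => Eucl d) i
  change l a = ∑ j, a j * l (EuclideanSpace.single j 1)
  conv_lhs => rw [h']
  simp only [map_sum, map_smul, smul_eq_mul]

theorem inner_grad (f : MultiTangent d n M → ℝ) (p : MultiTangent d n M) (w : FibreSpace d n) :
    inner ℝ w (A.grad f p) = A.vderiv f p w.toTuple := by
  rw [A.vderiv_eq_sum, PiLp.inner_apply, Fintype.sum_prod_type]
  refine Finset.sum_congr rfl fun i _ => ?_
  rw [A.sum_mul_vderiv_single]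
  refine Finset.sum_congr rfl fun j _ => ?_
  rw [grad_apply]
  exact mul_comm _ _

theorem measurable_grad {f : MultiTangent d n M → ℝ} (hf : IsSmoothOnTn f) :
    Measurable (A.grad f) := by
  refine (PiLp.continuous_toLp 2 _).measurable.comp (measurable_pi_lambda _ fun ij => ?_)
  exact A.measurable_vderiv hf measurable_const

/-- Cauchy–Schwarz against each of the `d` frame vectors, whose squared lengths are at most `A.C`.
-/
theorem norm_grad_sq_le {f : MultiTangent d n M → ℝ} (hf : IsSmoothOnTn f)
    (p : MultiTangent d n M) : ‖A.grad f p‖ ^ 2 ≤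
      d * A.C * ∑ i, g.inner p.base (vertGrad g f p i) (vertGrad g f p i) := by
  rw [EuclideanSpace.real_norm_sq_eq, Fintype.sum_prod_type, Finset.mul_sum]
  refine Finset.sum_le_sum fun i _ => ?_
  have h : ∀ j : Fin d, A.grad f p (i, j) ^ 2 ≤
      A.C * g.inner p.base (vertGrad g f p i) (vertGrad g f p i) := by
    intro j
    rw [grad_apply, ← A.inner_vertGrad hf]
    refine (SmoothMetric.inner_sq_le g _ _ _).trans ?_
    refine mul_le_mul_of_nonneg_right ?_ (SmoothMetric.inner_self_nonneg g _ _)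
    simpa using A.inner_frame_le p.base (EuclideanSpace.single j (1 : ℝ))
  refine (Finset.sum_le_sum fun j _ => h j).trans (le_of_eq ?_)
  simp [mul_assoc]

/-- Pair the difference `y` of gradients with itself in coordinates `a`: Cauchy–Schwarz and `‖a‖² ≤
C g(y, y)` bound `g(y, y)²`, and one factor `g(y, y)` is cancelled when it is nonzero. -/
theorem inner_vertGrad_sub_le {f h : MultiTangent d n M → ℝ} (hf : IsSmoothOnTn f)
    (hh : IsSmoothOnTn h) (p : MultiTangent d n M) :
    ∑ i, g.inner p.base (vertGrad g f p i - vertGrad g h p i)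
      (vertGrad g f p i - vertGrad g h p i) ≤ A.C * ‖A.grad f p - A.grad h p‖ ^ 2 := by
  rw [EuclideanSpace.real_norm_sq_eq, Fintype.sum_prod_type, Finset.mul_sum]
  refine Finset.sum_le_sum fun i _ => ?_
  set y := vertGrad g f p i - vertGrad g h p i with hy
  set a := A.coframe p.base y with ha
  have hya : A.frame p.base a = y := A.frame_coframe p.base y
  have h1 : g.inner p.base y y = ∑ j, a j * (A.grad f p - A.grad h p) (i, j) := by
    have e : g.inner p.base (A.frame p.base a) y =
        A.vderiv f p (Pi.single i a) - A.vderiv h p (Pi.single i a) := by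
      rw [← A.inner_vertGrad hf, ← A.inner_vertGrad hh, hy, map_sub]
    rw [hya, A.sum_mul_vderiv_single, A.sum_mul_vderiv_single, ← Finset.sum_sub_distrib] at e
    rw [e]
    refine Finset.sum_congr rfl fun j _ => ?_
    rw [← mul_sub]
    rfl
  have h2 : g.inner p.base y y ^ 2 ≤
      (∑ j, a j ^ 2) * ∑ j, (A.grad f p - A.grad h p) (i, j) ^ 2 := by
    rw [h1]
    exact Finset.sum_mul_sq_le_sq_mul_sq _ _ _
  have h3 : ∑ j, a j ^ 2 ≤ A.C * g.inner p.base y y := by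
    have := A.le_inner_frame p.base a
    rwa [EuclideanSpace.real_norm_sq_eq, hya] at this
  have h4 := SmoothMetric.inner_self_nonneg g p.base y
  have hC := A.C_pos
  have h5 : 0 ≤ ∑ j, (A.grad f p - A.grad h p) (i, j) ^ 2 :=
    Finset.sum_nonneg fun j _ => sq_nonneg _
  rcases h4.eq_or_lt with h0 | h0
  · rw [← h0]
    positivity
  · have h6 := h2.trans (mul_le_mul_of_nonneg_right h3 h5)
    refine le_of_mul_le_mul_left ?_ h0
    nlinarith

variable {μ : Measure (MultiTangent d n M)}

theorem memLp_grad {f : MultiTangent d n M → ℝ} (hf : IsSmoothOnTn f)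
    (h : MemL2 g μ (vertGrad g f)) : MemLp (A.grad f) 2 (μ.restrict μ.support) := by
  have hm := (A.measurable_grad hf).aestronglyMeasurable (μ := μ.restrict μ.support)
  rw [memLp_two_iff_integrable_sq_norm hm]
  refine ⟨hm.norm.pow 2, ?_⟩
  rw [hasFiniteIntegral_iff_norm]
  have hC := A.C_pos
  calc ∫⁻ p in μ.support, ENNReal.ofReal ‖‖A.grad f p‖ ^ 2‖ ∂μ
      ≤ ∫⁻ p in μ.support, ENNReal.ofReal (d * A.C) * ENNReal.ofReal
          (∑ i, g.inner p.base (vertGrad g f p i) (vertGrad g f p i)) ∂μ := by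
        refine lintegral_mono fun p => ?_
        dsimp only
        rw [← ENNReal.ofReal_mul (by positivity), Real.norm_of_nonneg (by positivity)]
        exact ENNReal.ofReal_le_ofReal (A.norm_grad_sq_le hf p)
    _ = ENNReal.ofReal (d * A.C) * sqNorm g μ (vertGrad g f) :=
        lintegral_const_mul' _ _ ENNReal.ofReal_ne_top
    _ < ⊤ := ENNReal.mul_lt_top ENNReal.ofReal_lt_top h.2

theorem sqNorm_sub_le {f h : MultiTangent d n M → ℝ} (hf : IsSmoothOnTn f) (hh : IsSmoothOnTn h)
    (hfm : MemLp (A.grad f) 2 (μ.restrict μ.support))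
    (hhm : MemLp (A.grad h) 2 (μ.restrict μ.support)) :
    sqNorm g μ (fun p j => vertGrad g f p j - vertGrad g h p j) ≤
      ENNReal.ofReal (A.C * ‖hfm.toLp - hhm.toLp‖ ^ 2) := by
  have hC := A.C_pos
  have hint : ‖hfm.toLp - hhm.toLp‖ ^ 2 =
      ∫ p in μ.support, ‖A.grad f p - A.grad h p‖ ^ 2 ∂μ := by
    rw [← real_inner_self_eq_norm_sq, ← MemLp.toLp_sub, L2.inner_def]
    refine integral_congr_ae ?_
    filter_upwards [(hfm.sub hhm).coeFn_toLp] with p hp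
    rw [hp, real_inner_self_eq_norm_sq]
    rfl
  rw [ENNReal.ofReal_mul hC.le, hint, ofReal_integral_eq_lintegral_ofReal
    (f := fun p => ‖A.grad f p - A.grad h p‖ ^ 2) ((memLp_two_iff_integrable_sq_norm (hfm.sub hhm).1).1 (hfm.sub hhm))
    (Eventually.of_forall fun p => by positivity), ← lintegral_const_mul' _ _ ENNReal.ofReal_ne_top]
  refine lintegral_mono fun p => ?_
  dsimp only
  rw [← ENNReal.ofReal_mul hC.le]
  exact ENNReal.ofReal_le_ofReal (A.inner_vertGrad_sub_le hf hh p)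

/-- The `L²` pairing is Euclidean in the chosen frame, so pairing `U` with the coordinate
differential is exactly differentiation along `U`; no orthonormal frame is required. -/
theorem integral_vderiv_eq_inner {f : MultiTangent d n M → ℝ}
    (hfm : MemLp (A.grad f) 2 (μ.restrict μ.support))
    (U : Lp (FibreSpace d n) 2 (μ.restrict μ.support)) :
    IntegrableOn (fun p => A.vderiv f p (U p).toTuple) μ.support μ ∧
      ∫ p in μ.support, A.vderiv f p (U p).toTuple ∂μ = inner ℝ U hfm.toLp := by
  have hae : (fun p => inner ℝ (U p) (MemLp.toLp (A.grad f) hfm p)) =ᵐ[μ.restrict μ.support]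
      fun p => A.vderiv f p (U p).toTuple := by
    filter_upwards [hfm.coeFn_toLp] with p hp
    rw [hp, A.inner_grad]
  exact ⟨(L2.integrable_inner U hfm.toLp).congr hae, by
    rw [L2.inner_def]; exact (integral_congr_ae hae).symm⟩

end ChartCover

/-! ### Removing the truncation and concluding by orthogonality. -/

namespace ChartCover

variable [IsManifold (𝓡 d) ∞ M] [T2Space M] {g : SmoothMetric d M} (A : ChartCover g)

/-- The form with differential `dy^{I 0} ∧ ⋯ ∧ dy^{I k}` near the points of `U c`. -/
def coordPrimitive (c : M) (I : Fin (k + 1) → Fin d) : SmoothForm d k M :=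
  bumpForm (A.bump c) (primitiveForm I) (contDiff_primitiveForm I)

theorem multivectorCoord_eq (u : MultiTangent d (k + 1) M → Fin (k + 1) → Eucl d)
    (I : Fin (k + 1) → Fin d) (p : MultiTangent d (k + 1) M) :
    A.multivectorCoord u I p =
      A.vderiv (A.coordPrimitive (A.center p.base) I).dEval p (u p) := by
  have h : ∀ w : Fin (k + 1) → Eucl d,
      A.formAt (A.coordPrimitive (A.center p.base) I).extD p.base w = coordForm I w := by
    intro w
    have h1 := dEval_bumpForm_primitiveForm (A.bump (A.center p.base)) I (A.tuple p.base w)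
      (A.mem_source p.base) (A.bump_eq_one _ _ (A.mem_U p.base))
    rw [show fibreCoord (A.center p.base) (A.tuple p.base w) = w from A.coord_tuple p.base w] at h1
    exact h1
  rw [← SmoothForm.eval_extD, A.vderiv_eq_sum, multivectorCoord]
  refine Finset.sum_congr rfl fun i _ => ?_
  rw [A.vderiv_eval_single, h]

variable {μ : Measure (MultiTangent d (k + 1) M)}

/-- By `multivectorCoord_eq` the coordinate is a pairing of two square-integrable fields. The form
involved depends on the chart chosen at `p`, so the sum over the finitely many centers serves as
dominating function. -/
theorem integrableOn_multivectorCoord (hgrad : ∀ θ : SmoothForm d k M, MemL2 g μ (vertGrad g θ.dEval))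
    (U : Lp (FibreSpace d (k + 1)) 2 (μ.restrict μ.support)) (I : Fin (k + 1) → Fin d) :
    IntegrableOn (A.multivectorCoord (fun p => (U p).toTuple) I) μ.support μ := by
  have hu : Measurable fun p => (U p).toTuple :=
    FibreSpace.measurable_toTuple.comp (Lp.stronglyMeasurable U).measurable
  have hint : Integrable (fun p => ∑ c ∈ A.centers,
      |A.vderiv (A.coordPrimitive c I).dEval p (U p).toTuple|) (μ.restrict μ.support) :=
    integrable_finsetSum _ fun c _ => (A.integral_vderiv_eq_inner
      (A.memLp_grad (A.coordPrimitive c I).isSmoothOnTn_dEval (hgrad _)) U).1.abs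
  refine hint.mono' (A.measurable_multivectorCoord hu I).aestronglyMeasurable
    (Eventually.of_forall fun p => ?_)
  rw [A.multivectorCoord_eq, Real.norm_eq_abs]
  exact Finset.single_le_sum
    (f := fun c => |A.vderiv (A.coordPrimitive c I).dEval p (U p).toTuple|)
    (fun c _ => abs_nonneg _) (A.center_mem p.base)

/-- The points with bounded coordinates and bounded value of the field. -/
def bounded (u : MultiTangent d n M → Fin n → Eucl d) (R : ℝ) : Set (MultiTangent d n M) :=
  {p | ‖A.coord p‖ ≤ R ∧ ‖u p‖ ≤ R}

theorem measurableSet_bounded {u : MultiTangent d n M → Fin n → Eucl d} (hu : Measurable u) (R : ℝ) :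
    MeasurableSet (A.bounded u R) :=
  (measurableSet_le A.measurable_coord.norm measurable_const).inter
    (measurableSet_le hu.norm measurable_const)

theorem monotone_bounded (u : MultiTangent d n M → Fin n → Eucl d) : Monotone (A.bounded u) :=
  fun _ _ h _ hp => ⟨hp.1.trans h, hp.2.trans h⟩

theorem iUnion_bounded (u : MultiTangent d n M → Fin n → Eucl d) :
    ⋃ m : ℕ, A.bounded u m = univ := by
  refine eq_univ_of_forall fun p => ?_
  obtain ⟨m, hm⟩ := exists_nat_ge (max ‖A.coord p‖ ‖u p‖)
  exact mem_iUnion.2 ⟨m, (le_max_left _ _).trans hm, (le_max_right _ _).trans hm⟩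

theorem measurableSet_support (μ : Measure (MultiTangent d n M)) : MeasurableSet μ.support :=
  Measure.isClosed_support.measurableSet

/-- The variation in the direction of a square-integrable field orthogonal to the vertical gradients
of exact forms, truncated at the level `R`. -/
def truncatedData (hgrad : ∀ θ : SmoothForm d k M, MemL2 g μ (vertGrad g θ.dEval))
    (U : Lp (FibreSpace d (k + 1)) 2 (μ.restrict μ.support))
    (hU : ∀ θ : SmoothForm d k M,
      inner ℝ U (A.memLp_grad θ.isSmoothOnTn_dEval (hgrad θ)).toLp = 0) (R : ℝ) :
    A.VariationData μ where
  u p := (U p).toTuple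
  S := μ.support ∩ A.bounded (fun p => (U p).toTuple) R
  P := μ.support \ A.bounded (fun p => (U p).toTuple) R
  R := R
  measurable_u := FibreSpace.measurable_toTuple.comp (Lp.stronglyMeasurable U).measurable
  measurableSet_S := (measurableSet_support μ).inter (A.measurableSet_bounded
    (FibreSpace.measurable_toTuple.comp (Lp.stronglyMeasurable U).measurable) R)
  norm_coord_le p hp := hp.2.1
  norm_u_le p hp := hp.2.2
  integrable_multivectorCoord I := (A.integrableOn_multivectorCoord hgrad U I).mono_set sdiff_subset
  orthogonal θ := by
    have h := A.integral_vderiv_eq_inner (A.memLp_grad θ.isSmoothOnTn_dEval (hgrad θ)) U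
    exact (integral_inter_add_sdiff (A.measurableSet_bounded (FibreSpace.measurable_toTuple.comp
      (Lp.stronglyMeasurable U).measurable) R) h.1).trans (h.2.trans (hU θ))

/-- Each truncation gives a nonnegative first variation. Integrability of `L` along `U` handles the
main term, and the correction terms are bounded by multiples of the vanishing tail mass. -/
theorem inner_grad_nonneg (hμ : IsHolonomic g μ) {L : MultiTangent d (k + 1) M → ℝ}
    (hL : IsSmoothOnTn L) (hcrit : IsCritical g L μ)
    (hLm : MemLp (A.grad L) 2 (μ.restrict μ.support))
    (hgrad : ∀ θ : SmoothForm d k M, MemL2 g μ (vertGrad g θ.dEval))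
    (U : Lp (FibreSpace d (k + 1)) 2 (μ.restrict μ.support))
    (hU : ∀ θ : SmoothForm d k M,
      inner ℝ U (A.memLp_grad θ.isSmoothOnTn_dEval (hgrad θ)).toLp = 0) :
    0 ≤ inner ℝ U hLm.toLp := by
  set u : MultiTangent d (k + 1) M → Fin (k + 1) → Eucl d := fun p => (U p).toTuple with hu
  have hum : Measurable u := FibreSpace.measurable_toTuple.comp (Lp.stronglyMeasurable U).measurable
  let F : ℕ → A.VariationData μ := fun m => A.truncatedData hgrad U hU m
  have hs := measurableSet_support μ
  have hP : ∀ m : ℕ, MeasurableSet (μ.support \ A.bounded u m) := fun m =>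
    hs.diff (A.measurableSet_bounded hum m)
  have hmono : Monotone fun m : ℕ => A.bounded u m := fun a b h =>
    A.monotone_bounded u (Nat.cast_le.2 h)
  -- The discarded sets decrease to the empty set, and the densities are integrable.
  have hmass : Tendsto (fun m => (F m).tailMass) atTop (𝓝 0) := by
    have h1 : ∀ I : Fin (k + 1) → Fin d, Tendsto (fun m : ℕ => ∫ p in μ.support \ A.bounded u m,
        |A.multivectorCoord u I p| / (k + 1).factorial ∂μ) atTop (𝓝 0) := by
      intro I
      have h := tendsto_setIntegral_of_antitone (μ := μ)
        (f := fun p => |A.multivectorCoord u I p| / (k + 1).factorial) hP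
        (fun a b hab => sdiff_subset_sdiff_right (hmono hab))
        ⟨0, ((A.integrableOn_multivectorCoord hgrad U I).mono_set sdiff_subset).abs.div_const _⟩
      rw [← sdiff_iUnion, A.iUnion_bounded, sdiff_univ, setIntegral_empty] at h
      exact h
    have h2 := tendsto_finsetSum Finset.univ fun I _ => h1 I
    rw [Finset.sum_const_zero] at h2
    exact h2
  have hS : Tendsto (fun m : ℕ => ∫ p in μ.support ∩ A.bounded u m, A.vderiv L p (u p) ∂μ) atTop
      (𝓝 (inner ℝ U hLm.toLp)) := by
    have h0 := A.integral_vderiv_eq_inner hLm U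
    have hun : ⋃ m : ℕ, μ.support ∩ A.bounded u m = μ.support := by
      rw [← inter_iUnion, A.iUnion_bounded, inter_univ]
    have h := tendsto_setIntegral_of_monotone (μ := μ) (f := fun p => A.vderiv L p (u p))
      (s := fun m : ℕ => μ.support ∩ A.bounded u m)
      (fun m => hs.inter (A.measurableSet_bounded hum m))
      (fun a b hab => inter_subset_inter_right _ (hmono hab)) (by rw [hun]; exact h0.1)
    rw [hun, h0.2] at h
    exact h
  obtain ⟨B, hB0, hB⟩ := A.exists_bound hL.continuous 1
  have htail : Tendsto (fun m => ∫ p, L p ∂(F m).tail) atTop (𝓝 0) := by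
    refine squeeze_zero_norm (a := fun m => B * (F m).tailMass)
      (fun m => (F m).abs_integral_tail_le hL.continuous.measurable hB) ?_
    simpa using hmass.const_mul B
  have hlim := (hS.sub (hmass.mul_const (∫ p, L p ∂μ))).add htail
  rw [zero_mul, sub_zero, add_zero] at hlim
  refine ge_of_tendsto' hlim fun m => ?_
  have h := (F m).firstVariation_nonneg hμ hL hcrit
  rw [VariationData.firstVariation, (F m).integral_vderiv_w] at h
  exact h

/-- The classes in `L²` of the vertical gradients of exact forms. -/
def exactGradients (hgrad : ∀ θ : SmoothForm d k M, MemL2 g μ (vertGrad g θ.dEval)) :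
    Submodule ℝ (Lp (FibreSpace d (k + 1)) 2 (μ.restrict μ.support)) where
  carrier := {x | ∃ θ : SmoothForm d k M,
    (A.memLp_grad θ.isSmoothOnTn_dEval (hgrad θ)).toLp = x}
  zero_mem' := by
    refine ⟨0, ?_⟩
    have h : A.grad (0 : SmoothForm d k M).dEval = 0 := by
      funext p
      ext ij
      have h0 : (0 : SmoothForm d k M).dEval = 0 := funext fun q => SmoothForm.dEval_zero q
      rw [h0, grad_apply, vderiv]
      simp
    rw [← MemLp.toLp_zero (MemLp.zero' (ε := FibreSpace d (k + 1)))]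
    exact MemLp.toLp_congr _ _ (by rw [h])
  add_mem' := by
    rintro _ _ ⟨θ₁, rfl⟩ ⟨θ₂, rfl⟩
    refine ⟨θ₁ + θ₂, ?_⟩
    have h : A.grad (θ₁ + θ₂).dEval = A.grad θ₁.dEval + A.grad θ₂.dEval := by
      funext p
      ext ij
      have h0 : (θ₁ + θ₂).dEval = θ₁.dEval + θ₂.dEval :=
        funext fun q => SmoothForm.dEval_add θ₁ θ₂ q
      rw [h0, grad_apply, A.vderiv_add θ₁.isSmoothOnTn_dEval θ₂.isSmoothOnTn_dEval]
      rfl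
    rw [← MemLp.toLp_add]
    exact MemLp.toLp_congr _ _ (by rw [h])
  smul_mem' := by
    rintro a _ ⟨θ, rfl⟩
    refine ⟨a • θ, ?_⟩
    have h : A.grad (a • θ).dEval = a • A.grad θ.dEval := by
      funext p
      ext ij
      have h0 : (a • θ).dEval = a • θ.dEval := funext fun q => SmoothForm.dEval_smul a θ q
      rw [h0, grad_apply, A.vderiv_smul θ.isSmoothOnTn_dEval]
      rfl
    rw [← MemLp.toLp_const_smul]
    exact MemLp.toLp_congr _ _ (by rw [h])

/-- The closure of a subspace is its double orthogonal complement. Criticality is one-sided, but the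
complement is symmetric under `U ↦ -U`, so the inequality becomes an equality. -/
theorem grad_mem_closure (hμ : IsHolonomic g μ) {L : MultiTangent d (k + 1) M → ℝ}
    (hL : IsSmoothOnTn L) (hcrit : IsCritical g L μ)
    (hLm : MemLp (A.grad L) 2 (μ.restrict μ.support))
    (hgrad : ∀ θ : SmoothForm d k M, MemL2 g μ (vertGrad g θ.dEval)) :
    hLm.toLp ∈ (A.exactGradients hgrad).topologicalClosure := by
  rw [← Submodule.orthogonal_orthogonal_eq_closure, Submodule.mem_orthogonal]
  have key : ∀ U ∈ (A.exactGradients hgrad)ᗮ, 0 ≤ inner ℝ U hLm.toLp := fun U hU =>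
    A.inner_grad_nonneg hμ hL hcrit hLm hgrad U fun θ =>
      Submodule.inner_left_of_mem_orthogonal
        (show (A.memLp_grad θ.isSmoothOnTn_dEval (hgrad θ)).toLp ∈ A.exactGradients hgrad from
          ⟨θ, rfl⟩) hU
  intro U hU
  have h1 := key (-U) (neg_mem hU)
  rw [inner_neg_left] at h1
  exact le_antisymm (by linarith) (key U hU)

end ChartCover

end

theorem mainTheorem6 {d k : ℕ} {M : Type*} [TopologicalSpace M] [T2Space M] [CompactSpace M]
    [ChartedSpace (Eucl d) M] [IsManifold (𝓡 d) ∞ M] (hk : k + 1 ≤ d)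
    (g : SmoothMetric d M)
    (L : MultiTangent d (k + 1) M → ℝ) (hL : IsSmoothOnTn L)
    (μ : Measure (MultiTangent d (k + 1) M)) (hμ : IsHolonomic g μ)
    (hcrit : IsCritical g L μ)
    (hgradL : MemL2 g μ (vertGrad g L))
    (hgradForms : ∀ θ : SmoothForm d k M, MemL2 g μ (vertGrad g θ.dEval)) :
    ∃ θ : ℕ → SmoothForm d k M,
      TendstoL2 g μ (fun i => vertGrad g (θ i).dEval) (vertGrad g L) := by
  obtain ⟨A⟩ := nonempty_chartCover g
  have hLm := A.memLp_grad hL hgradL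
  have hmem := A.grad_mem_closure hμ hL hcrit hLm hgradForms
  obtain ⟨x, hx, hlim⟩ := mem_closure_iff_seq_limit.1
    (show hLm.toLp ∈ closure (A.exactGradients hgradForms :
      Set (Lp (FibreSpace d (k + 1)) 2 (μ.restrict μ.support))) from hmem)
  choose θ hθ using hx
  refine ⟨θ, fun i => hgradForms (θ i), hgradL, ?_⟩
  -- Convergence in the coordinate `L²` space passes to the metric norm through the bound
  -- `sqNorm_sub_le`.
  have h1 : Tendsto (fun i => ENNReal.ofReal (A.C * ‖x i - hLm.toLp‖ ^ 2)) atTop (𝓝 0) := by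
    have h2 : Tendsto (fun i => A.C * ‖x i - hLm.toLp‖ ^ 2) atTop (𝓝 0) := by
      simpa using ((tendsto_iff_norm_sub_tendsto_zero.1 hlim).pow 2).const_mul A.C
    simpa using ENNReal.tendsto_ofReal h2
  refine tendsto_of_tendsto_of_tendsto_of_le_of_le tendsto_const_nhds h1 (fun _ => zero_le)
    fun i => ?_
  dsimp only
  rw [← hθ i]
  exact A.sqNorm_sub_le (θ i).isSmoothOnTn_dEval hL _ hLm
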